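/- Graphs are simple. A path of a graph $G$ is a sequence of distinct vertices, two of which are adjacent in $G$ if and only if they are consecutive. A hole is a chordless cycle of length at least four; it is even if its length is even. Let $l\ge 1$ and $k\ge 4$ be integers. A graph $G$ is an $(l,k)$-ehf-layered-wheel if $V(G)$ is partitioned into paths (layers) $P_0,P_1,\dots,P_l$, each oriented from left to right, such that the conditions below hold. For $u\in V(P_i)$, the ancestors of $u$ are its neighbors in $P_0\cup\dots\cup P_{i-1}$, and the type of $u$ is the number of its ancestors. 1. $P_0$ consists of a single vertex $r$. The vertex $r$ has exactly three neighbors $r_1,r_2,r_3$ in $P_1$ (in this order along $P_1$), and $r_1$ and $r_3$ are the ends of $P_1$. 2. For $2\le j\le l$, both ends of $P_j$ have type at least $1$, and the vertices of $P_j$ of type at least $1$ are distributed over pairwise disjoint subpaths of $P_j$, called zones. A zone $E_u$ (resp. $O_u$) contains exactly four (resp. three) vertices of type at least $1$, and each of them has $u$ as its only ancestor. A zone $E_{u,v}$ (resp. $O_{u,v}$) contains exactly four (resp. three) vertices of type at least $1$, and each of them has exactly the two ancestors $u$ and $v$. The ends of a zone are vertices of type at least $1$. Write $P_{j-1}=p_1p_2\cdots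 p_n$. From left to right along $P_j$, the zones are: the private zones of $p_1$, then $E_{p_1,p_2}$, then the private zones of $p_2$, then $E_{p_2,p_3}$, and so on, up to $E_{p_{n-1},p_n}$ and the private zones of $p_n$. The private zones of a vertex $u$ of $P_{j-1}$ are, from left to right: - $O_u$, if $u$ has type $0$; - $O_u,\ O_{u,v},\ O_u$, if $u$ has type $1$ with ancestor $v$; - $E_u,\ E_{v,w},\ O_u,\ O_{u,v},\ O_u,\ O_{u,w},\ O_u,\ E_{v,w},\ E_u$, if $u$ has type $2$ with ancestors $v,w$, named so that either $v$ lies in a later layer than $w$, or $v$ and $w$ lie in the same layer and $v$ is to the left of $w$. (With these rules, every vertex has type $0$, $1$ or $2$.) 3. For $1\le j\le l$, let $x,y$ be two distinct vertices of $P_j$ of type at least $1$ such that all vertices strictly between them on $P_j$ have type $0$. Then the subpath of $P_j$ from $x$ to $y$ has length at least $k-2$, and its length is odd if $x$ and $y$ have a common ancestor and even otherwise. **Theorem.** For all integers $l\ge 1$ and $k\ge 4$, every $(l,k)$-ehf-layered-wheel $G$ contains no even hole and no $K_4$, and every hole in $G$ has length at least $k$. -/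

import Mathlib

namespace LayeredWheel

open scoped Classical in
/-- The ancestors of a vertex `u` of the layer `P i`: its neighbours in `P 0, …, P (i - 1)`.
They are listed from the latest layer to the earliest one, and from left to right inside
a layer. So for a vertex with two ancestors the list is `[v, w]`, where either `v` lies in a
later layer than `w`, or both lie in the same layer and `v` is to the left of `w`. -/
noncomputable def ancestors {V : Type*} (G : SimpleGraph V) (P : ℕ → List V) (i : ℕ) (u : V) :
    List V :=
  ((List.range i).reverse.flatMap P).filter (fun v => decide (G.Adj u v))

/-- `p` is a path of `G`, given as the list of its vertices from left to right: they are distinct,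
and two of them are adjacent in `G` exactly when they are consecutive in the list. -/
def IsPathIn {V : Type*} (G : SimpleGraph V) (p : List V) : Prop :=
  p.Nodup ∧ ∀ (a b : ℕ) (ha : a < p.length) (hb : b < p.length),
    G.Adj p[a] p[b] ↔ a + 1 = b ∨ b + 1 = a

/-- A zone is described by the number of its marked vertices (those that have ancestors) and by
its centers: all the marked vertices have exactly these centers as ancestors. -/
structure Zone (V : Type*) where
  size : ℕ
  centers : List V

/-- The zone `E_u`. -/
def zoneE {V : Type*} (u : V) : Zone V := ⟨4, [u]⟩

/-- The zone `O_u`. -/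
def zoneO {V : Type*} (u : V) : Zone V := ⟨3, [u]⟩

/-- The zone `E_{u, v}`. -/
def zoneEE {V : Type*} (u v : V) : Zone V := ⟨4, [u, v]⟩

/-- The zone `O_{u, v}`. -/
def zoneOO {V : Type*} (u v : V) : Zone V := ⟨3, [u, v]⟩

/-- The zones of the box of `u` other than the ones shared with the boxes of the left and right
neighbours of `u` in its layer, from left to right. The second argument is the list of the
ancestors of `u`. (There are never more than two of them, so the last case is void.) -/
def privateZones {V : Type*} (u : V) : List V → List (Zone V)
  | [] => [zoneO u]
  | [v] => [zoneO u, zoneOO u v, zoneO u]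
  | [v, w] => [zoneE u, zoneEE v w, zoneO u, zoneOO u v, zoneO u, zoneOO u w, zoneO u,
      zoneEE v w, zoneE u]
  | _ => []

/-- The zones, from left to right, of the layer built over the layer `p`; `anc u` is the list of
ancestors of the vertex `u` of `p`. The box of a vertex `u` of `p`, with left neighbour `u'` and
right neighbour `u''` in `p`, consists of the zone `E_{u', u}` (if `u'` exists), the private zones
of `u`, and the zone `E_{u, u''}` (if `u''` exists); the boxes come in the order of the vertices
of `p`, and the boxes of two adjacent vertices share one zone. -/
def zones {V : Type*} (anc : V → List V) : List V → List (Zone V)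
  | [] => []
  | [u] => privateZones u (anc u)
  | u :: u'' :: p => privateZones u (anc u) ++ zoneEE u u'' :: zones anc (u'' :: p)

/-- `P 0, …, P l` are the layers, each listed from left to right, of an `(l, k)`-ehf-layered-wheel
`G`. -/
structure IsLayering {V : Type*} (G : SimpleGraph V) (l k : ℕ) (P : ℕ → List V) : Prop where
  /-- The layers partition the vertex set. -/
  partition : ∀ x : V, ∃! i, i ≤ l ∧ x ∈ P i
  /-- Every layer is a path. -/
  isPath : ∀ i ≤ l, IsPathIn G (P i)
  /-- The first layer is a single vertex. -/
  root : ∃ r, P 0 = [r]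
  /-- Along each layer from left to right, the vertices that have ancestors have exactly the
  ancestors prescribed by the successive zones. For `i = 0` the only zone is `O_r`, so that the
  root `r` has exactly three neighbours in the second layer. -/
  marked : ∀ i < l,
    ((P (i + 1)).map (ancestors G P (i + 1))).filter (fun A => !A.isEmpty) =
      (zones (ancestors G P i) (P i)).flatMap (fun Z => List.replicate Z.size Z.centers)
  /-- The two ends of every layer but the first have ancestors. -/
  ends : ∀ i < l, ∀ u, (P (i + 1)).head? = some u ∨ (P (i + 1)).getLast? = some u →
    ancestors G P (i + 1) u ≠ []
  /-- The length of the path between two consecutive vertices that have ancestors. -/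
  gaps : ∀ i < l, ∀ (a b : ℕ) (hab : a < b) (hb : b < (P (i + 1)).length),
    ancestors G P (i + 1) (P (i + 1))[a] ≠ [] →
    ancestors G P (i + 1) (P (i + 1))[b] ≠ [] →
    (∀ (c : ℕ) (_ : a < c) (_ : c < b), ancestors G P (i + 1) (P (i + 1))[c] = []) →
      k ≤ (b - a) + 2 ∧
      ((∃ x, x ∈ ancestors G P (i + 1) (P (i + 1))[a] ∧
          x ∈ ancestors G P (i + 1) (P (i + 1))[b]) → Odd (b - a)) ∧
      ((¬ ∃ x, x ∈ ancestors G P (i + 1) (P (i + 1))[a] ∧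
          x ∈ ancestors G P (i + 1) (P (i + 1))[b]) → Even (b - a))

/-- `G` is an `(l, k)`-ehf-layered-wheel. -/
def IsEhfLayeredWheel {V : Type*} (l k : ℕ) (G : SimpleGraph V) : Prop :=
  ∃ P : ℕ → List V, IsLayering G l k P

/-- A hole is a chordless cycle of length at least four. -/
def IsHole {V : Type*} {G : SimpleGraph V} {v : V} (c : G.Walk v v) : Prop :=
  c.IsCycle ∧ c.IsChordless ∧ 4 ≤ c.length

end LayeredWheel

/-! The core is that every induced cycle, triangles included, is odd; triangles are admitted because
a sector of a wheel may be a single edge. Induct on the highest layer the cycle may use and, inside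
that, on the number of its vertices in that layer. Let `S` be an even induced cycle with last
possible layer `P (i + 1)`, and suppose that cycles with a smaller trace there are odd. If a vertex
`u` of `P i` outside `S` has at least three neighbours of `S` in the top layer, then `u` together
with a sector of `S` is an induced cycle containing only two of them, hence odd. Adding up the
sectors (`InducedCycle.parity_of_wheel`), the number of neighbours of `u` on `S` has the parity of
the length of `S`, so it is even. A vertex of `P i` on `S` has exactly two neighbours on `S`.

The zones are designed to contradict this. Call the stretch between two consecutive zones an open
gate if `S` contains it. If no centre of a zone is in `S`, then `S` contains all or none of the
zone. If exactly one centre is in `S`, an arc of `S` entering the zone stops at its first marked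
vertex: an arc between two consecutive marked vertices would close up with the centre to an odd
cycle. If two centres are in `S`, they are adjacent, and any marked vertex of the zone on `S` would
create a triangle. So the degree of `u` is a linear expression in the 0/1 values of the gates and in
the membership of its ancestors in `S`. In each of the three types, an open gate in the box of a `u`
outside `S` gives at least three top neighbours and an odd total (`Trace.type_zero`,
`Trace.type_one`, `Trace.type_two`), while for `u` in `S` the gap parities close the gates directly.
Hence no gate is open, `S` misses the layer (`IsLayering.notMem_of_minimal`), and the outer
induction applies.

The bound `k` is local: in the highest layer it meets, a hole contains a full gap and an ancestor of
an end of it (`TopLayer.le_length`). A `K₄` is excluded because vertices have at most two ancestors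
and two consecutive vertices of a layer are never both marked. -/

namespace LayeredWheel

/-! ### Induced cycles as periodic sequences. -/

variable {V : Type*} {G : SimpleGraph V}

/-- `F` runs periodically, with period `n`, along an induced cycle of length `n` (triangles are
allowed). -/
structure InducedCycle (G : SimpleGraph V) (n : ℕ) (F : ℕ → V) : Prop where
  three_le : 3 ≤ n
  period : ∀ a, F (a + n) = F a
  -- The shift `d = n - 1` is left out: by periodicity it is a shift by `1` read from the other end.
  ne_adj : ∀ a d, 1 ≤ d → d + 2 ≤ n → F a ≠ F (a + d) ∧ (G.Adj (F a) (F (a + d)) ↔ d = 1)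

theorem inducedCycle_of_window {n : ℕ} (hn : 3 ≤ n) {h : ℕ → V}
    (H : ∀ a b, a < b → b < n → h a ≠ h b ∧
      (G.Adj (h a) (h b) ↔ b = a + 1 ∨ (a = 0 ∧ b + 1 = n))) :
    InducedCycle G n (fun t => h (t % n)) := by
  refine ⟨hn, fun a => by simp, fun a d hd hdn => ?_⟩
  have hr : a % n < n := Nat.mod_lt _ (by omega)
  have hm : (a + d) % n = if a % n + d < n then a % n + d else a % n + d - n := by
    rw [Nat.add_mod, Nat.mod_eq_of_lt (show d < n by omega)]
    split_ifs with h1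
    · exact Nat.mod_eq_of_lt h1
    · rw [Nat.mod_eq_sub_mod (by omega), Nat.mod_eq_of_lt (by omega)]
  simp only [hm]
  generalize a % n = r at *
  split_ifs with h1
  · obtain ⟨h2, h3⟩ := H r (r + d) (by omega) h1
    refine ⟨h2, h3.trans ?_⟩
    omega
  · obtain ⟨h2, h3⟩ := H (r + d - n) r (by omega) hr
    refine ⟨h2.symm, (G.adj_comm _ _).trans (h3.trans ?_)⟩
    omega

namespace InducedCycle

variable {n : ℕ} {F : ℕ → V}

theorem rotate (hF : InducedCycle G n F) (c : ℕ) : InducedCycle G n (fun a => F (c + a)) :=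
  ⟨hF.three_le, fun a => by rw [← add_assoc, hF.period], fun a d h1 h2 => by
    rw [← add_assoc]; exact hF.ne_adj _ _ h1 h2⟩

theorem period_mul (hF : InducedCycle G n F) (a k : ℕ) : F (a + k * n) = F a := by
  induction k with
  | zero => simp
  | succ k ih => rw [Nat.succ_mul, ← add_assoc, hF.period, ih]

theorem exists_offset (hF : InducedCycle G n F) (a b : ℕ) : ∃ d < n, F b = F (a + d) := by
  have hn : 0 < n := by have := hF.three_le; omega
  refine ⟨(b + a * n - a) % n, Nat.mod_lt _ hn, ?_⟩
  -- Adding `a` full periods to `b` makes the truncated subtraction of `a` exact.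
  have h1 : a ≤ b + a * n := by nlinarith
  rw [← hF.period_mul b a, ← hF.period_mul (a + _) ((b + a * n - a) / n)]
  congr 1
  have := Nat.mod_add_div' (b + a * n - a) n
  omega

theorem adj_succ (hF : InducedCycle G n F) (a : ℕ) : G.Adj (F a) (F (a + 1)) :=
  (hF.ne_adj a 1 le_rfl (by have := hF.three_le; omega)).2.2 rfl

theorem adj_pred (hF : InducedCycle G n F) (a : ℕ) : G.Adj (F a) (F (a + (n - 1))) := by
  have := hF.adj_succ (a + (n - 1))
  rw [add_assoc, Nat.sub_add_cancel (by have := hF.three_le; omega), hF.period] at this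
  exact this.symm

theorem eq_or_eq_of_adj (hF : InducedCycle G n F) {a b : ℕ} (h : G.Adj (F a) (F b)) :
    F b = F (a + 1) ∨ F b = F (a + (n - 1)) := by
  obtain ⟨d, hd, e⟩ := hF.exists_offset a b
  rcases Nat.eq_zero_or_pos d with rfl | hd0
  · simp only [add_zero] at e
    rw [e] at h
    exact absurd rfl h.ne
  by_cases h2 : d + 2 ≤ n
  · rw [e] at h ⊢
    rw [(hF.ne_adj a d hd0 h2).2.1 h]
    exact Or.inl rfl
  · right
    rw [e, show d = n - 1 by omega]

theorem succ_ne_pred (hF : InducedCycle G n F) (a : ℕ) : F (a + 1) ≠ F (a + (n - 1)) := by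
  have := hF.three_le
  have h := (hF.ne_adj (a + 1) (n - 2) (by omega) (by omega)).1
  rwa [add_assoc, show 1 + (n - 2) = n - 1 by omega] at h

theorem injOn (hF : InducedCycle G n F) : Set.InjOn F (Finset.range n) := by
  have key : ∀ a b, a < b → b < n → F a ≠ F b := by
    intro a b hab hb
    obtain ⟨d, rfl⟩ := Nat.exists_eq_add_of_lt hab
    rw [add_assoc]
    by_cases h2 : d + 1 + 2 ≤ n
    · exact (hF.ne_adj a (d + 1) (by omega) h2).1
    · rw [show d + 1 = n - 1 by omega]
      exact (hF.adj_pred a).ne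
  intro a ha b hb h
  simp only [Finset.coe_range, Set.mem_Iio] at ha hb
  rcases lt_trichotomy a b with h1 | h1 | h1
  · exact absurd h (key a b h1 hb)
  · exact h1
  · exact absurd h.symm (key b a h1 ha)

open scoped Classical in
/-- The vertices of an induced cycle. -/
noncomputable def verts (n : ℕ) (F : ℕ → V) : Finset V := (Finset.range n).image F

theorem mem_verts (hF : InducedCycle G n F) {x : V} : x ∈ verts n F ↔ ∃ a, F a = x := by
  classical
  simp only [verts, Finset.mem_image, Finset.mem_range]
  refine ⟨fun ⟨a, _, h⟩ => ⟨a, h⟩, fun ⟨a, h⟩ => ?_⟩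
  obtain ⟨d, hd, e⟩ := hF.exists_offset 0 a
  exact ⟨d, hd, by rw [← h, e, zero_add]⟩

theorem card_verts (hF : InducedCycle G n F) : (verts n F).card = n := by
  classical
  rw [verts, Finset.card_image_of_injOn hF.injOn, Finset.card_range]

open scoped Classical in
theorem card_neighbors (hF : InducedCycle G n F) {x : V} (hx : x ∈ verts n F) :
    ((verts n F).filter (fun y => G.Adj x y)).card = 2 := by
  obtain ⟨a, rfl⟩ := hF.mem_verts.1 hx
  have : (verts n F).filter (fun y => G.Adj (F a) y) = {F (a + 1), F (a + (n - 1))} := by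
    ext y
    simp only [Finset.mem_filter, Finset.mem_insert, Finset.mem_singleton, hF.mem_verts]
    constructor
    · rintro ⟨⟨b, rfl⟩, h⟩
      exact hF.eq_or_eq_of_adj h
    · rintro (rfl | rfl)
      · exact ⟨⟨_, rfl⟩, hF.adj_succ a⟩
      · exact ⟨⟨_, rfl⟩, hF.adj_pred a⟩
  rw [this, Finset.card_pair (hF.succ_ne_pred a)]

/-- Walking along the cycle from a vertex of `T` never leaves `T`. -/
theorem eq_verts_of_closed (hF : InducedCycle G n F) {T : Finset V} (hT : T ⊆ verts n F)
    (hne : T.Nonempty) (hc : ∀ x ∈ T, ∀ y ∈ verts n F, G.Adj x y → y ∈ T) : T = verts n F := by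
  obtain ⟨x, hx⟩ := hne
  obtain ⟨a, rfl⟩ := hF.mem_verts.1 (hT hx)
  have h : ∀ d, F (a + d) ∈ T := by
    intro d
    induction d with
    | zero => exact hx
    | succ d ih => exact hc _ ih _ (hF.mem_verts.2 ⟨_, rfl⟩) (hF.adj_succ _)
  refine Finset.Subset.antisymm hT fun y hy => ?_
  obtain ⟨b, rfl⟩ := hF.mem_verts.1 hy
  obtain ⟨d, _, e⟩ := hF.exists_offset a b
  rw [e]
  exact h d

/-! ### Wheels: sectors and parity. -/

theorem exists_sector (hF : InducedCycle G n F) {u : V} (hu : ∀ a, F a ≠ u) {i j : ℕ}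
    (hij : i < j) (hjn : j + 2 ≤ i + n) (hi : G.Adj u (F i)) (hj : G.Adj u (F j))
    (hb : ∀ t, i < t → t < j → ¬ G.Adj u (F t)) :
    ∃ F', InducedCycle G (j - i + 2) F' ∧ (∃ a, F' a = u) ∧
      ∀ a, F' a = u ∨ ∃ b, F' a = F b := by
  -- The centre comes first, then the sector. The bound `j + 2 ≤ i + n` keeps the two ends of the
  -- sector from being adjacent through the rest of the cycle, which would be a chord.
  refine ⟨_, inducedCycle_of_window (h := fun t => if t = 0 then u else F (i + (t - 1)))
    (by omega) ?_, ⟨0, by simp⟩, fun a => ?_⟩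
  · intro a b hab hbn
    have hb0 : b ≠ 0 := by omega
    simp only [hb0, if_false]
    split_ifs with ha
    · refine ⟨(hu _).symm, ⟨fun h => ?_, ?_⟩⟩
      · by_contra hcon
        exact hb (i + (b - 1)) (by omega) (by omega) h
      · rintro (h | h)
        · subst h; subst ha; simpa using hi
        · rwa [show i + (b - 1) = j by omega]
    · have := hF.ne_adj (i + (a - 1)) (b - a) (by omega) (by omega)
      rw [show i + (a - 1) + (b - a) = i + (b - 1) by omega] at this
      refine ⟨this.1, this.2.trans ?_⟩
      omega
  · by_cases h : a % (j - i + 2) = 0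
    · left; simp [h]
    · right; exact ⟨i + (a % (j - i + 2) - 1), by simp [h]⟩

open scoped Classical in
-- Two successive neighbours of `u` at positions `i < j` bound a sector that closes up with `u` to a
-- cycle of odd length `j - i + 2`. So the position changes parity exactly when one more neighbour
-- has been counted.
theorem parity_aux (hF : InducedCycle G n F) {u : V} (hu : ∀ a, F a ≠ u)
    (h0 : G.Adj u (F 0)) (h3 : 3 ≤ ((Finset.range n).filter (fun a => G.Adj u (F a))).card)
    (hodd : ∀ n' F', InducedCycle G n' F' → (∃ a, F' a = u) →
      (∀ a, F' a = u ∨ ∃ b, F' a = F b) → Odd n') :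
    ∀ j ≤ n, G.Adj u (F j) →
      (((Finset.range j).filter (fun a => G.Adj u (F a))).card + j) % 2 = 0 := by
  intro j
  induction j using Nat.strong_induction_on with
  | _ j ih =>
  intro hjn hj
  rcases Nat.eq_zero_or_pos j with rfl | hj0
  · simp
  set N := (Finset.range j).filter (fun a => G.Adj u (F a)) with hN
  have hne : N.Nonempty := ⟨0, by simp [hN, hj0, h0]⟩
  set i := N.max' hne with hi
  have hiN : i ∈ N := N.max'_mem hne
  have hij : i < j := by simpa using (Finset.mem_filter.1 hiN).1
  have hiu : G.Adj u (F i) := (Finset.mem_filter.1 hiN).2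
  have hb : ∀ t, i < t → t < j → ¬ G.Adj u (F t) := fun t h1 h2 h => by
    have : t ≤ i := N.le_max' t (by simp [hN, h2, h])
    omega
  -- Otherwise all neighbours of `u` lie at positions up to `i` or from `j` to `n - 1`, which leaves
  -- room for at most two of them.
  have hlen : j + 2 ≤ i + n := by
    by_contra hcon
    have hsub : (Finset.range n).filter (fun a => G.Adj u (F a)) ⊆
        Finset.range (i + 1) ∪ Finset.Ico j n := by
      intro t ht
      simp only [Finset.mem_filter, Finset.mem_range, Finset.mem_union, Finset.mem_Ico] at ht ⊢
      by_contra hc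
      exact hb t (by omega) (by omega) ht.2
    have := (Finset.card_le_card hsub).trans (Finset.card_union_le _ _)
    simp only [Finset.card_range, Nat.card_Ico] at this
    omega
  obtain ⟨F', hF', h1, h2⟩ := hF.exists_sector hu hij hlen hiu hj hb
  have ho := hodd _ _ hF' h1 h2
  have hI := ih i hij (by omega) hiu
  have hNi : N = insert i ((Finset.range i).filter (fun a => G.Adj u (F a))) := by
    ext t
    simp only [hN, Finset.mem_filter, Finset.mem_range, Finset.mem_insert]
    constructor
    · rintro ⟨h3, h4⟩
      by_cases h5 : i < t
      · exact absurd h4 (hb t h5 h3)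
      · rcases Nat.lt_or_eq_of_le (not_lt.1 h5) with h6 | h6
        · exact Or.inr ⟨h6, h4⟩
        · exact Or.inl h6
    · rintro (rfl | ⟨h3, h4⟩)
      · exact ⟨hij, hiu⟩
      · exact ⟨by omega, h4⟩
  rw [hNi, Finset.card_insert_of_notMem (by simp)]
  have := Nat.odd_iff.1 ho
  omega

open scoped Classical in
/-- If a vertex `u` off an induced cycle has at least three neighbours on it, and all the induced
cycles formed by `u` and a sector are odd, then the length of the cycle has the parity of the number
of neighbours of `u`. -/
theorem parity_of_wheel (hF : InducedCycle G n F) {u : V} (hu : u ∉ verts n F)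
    (h3 : 3 ≤ ((verts n F).filter (fun y => G.Adj u y)).card)
    (hodd : ∀ n' F', InducedCycle G n' F' → u ∈ verts n' F' →
      (∀ x ∈ verts n' F', x = u ∨ x ∈ verts n F) → Odd n') :
    (((verts n F).filter (fun y => G.Adj u y)).card + n) % 2 = 0 := by
  have hex : ∃ c, G.Adj u (F c) := by
    obtain ⟨y, hy⟩ := Finset.card_pos.1 (lt_of_lt_of_le (by norm_num) h3)
    obtain ⟨hy1, hy2⟩ := Finset.mem_filter.1 hy
    obtain ⟨c, rfl⟩ := hF.mem_verts.1 hy1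
    exact ⟨c, hy2⟩
  obtain ⟨c, hc⟩ := hex
  have hR := hF.rotate c
  have hv : verts n (fun a => F (c + a)) = verts n F := by
    ext x
    rw [hR.mem_verts, hF.mem_verts]
    constructor
    · rintro ⟨a, h⟩; exact ⟨_, h⟩
    · rintro ⟨a, rfl⟩
      obtain ⟨d, _, e⟩ := hF.exists_offset c a
      exact ⟨d, e.symm⟩
  have hcard : ((verts n F).filter (fun y => G.Adj u y)).card =
      ((Finset.range n).filter (fun a => G.Adj u (F (c + a)))).card := by
    rw [← hv, verts, Finset.filter_image, Finset.card_image_of_injOn]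
    exact hR.injOn.mono (Finset.coe_subset.2 (Finset.filter_subset _ _))
  have hu' : ∀ a, F (c + a) ≠ u := fun a h => hu (hF.mem_verts.2 ⟨_, h⟩)
  rw [hcard] at h3 ⊢
  refine hR.parity_aux hu' hc h3 (fun n' F' hF' h1 h2 => ?_) n le_rfl ?_
  · refine hodd n' F' hF' (hF'.mem_verts.2 h1) fun x hx => ?_
    obtain ⟨a, rfl⟩ := hF'.mem_verts.1 hx
    rcases h2 a with h | ⟨b, h⟩
    · exact Or.inl h
    · exact Or.inr (hF.mem_verts.2 ⟨_, h.symm⟩)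
  -- Position `n` is position `0` again, so the last sector is closed at `j = n`.
  · have := hR.period 0
    simp only [zero_add] at this
    rw [this]; exact hc

end InducedCycle

/-! ### From chordless closed walks to induced cycles. -/

theorem IsHole.inducedCycle {v : V} {c : G.Walk v v} (h : IsHole c) :
    ∃ F, InducedCycle G c.length F := by
  obtain ⟨hc, hch, h4⟩ := h
  have hw : ∀ a b, a < b → b < c.length → c.getVert a ≠ c.getVert b ∧
      (G.Adj (c.getVert a) (c.getVert b) ↔ b = a + 1 ∨ (a = 0 ∧ b + 1 = c.length)) := by
    intro a b hab hb
    have inj := hc.getVert_injOn'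
    refine ⟨fun h => ?_, fun h => ?_, ?_⟩
    · have := inj (by simp; omega) (by simp; omega) h
      omega
    · have he := hch.mem_edges (c.getVert_mem_support a) (c.getVert_mem_support b) h
      obtain ⟨i, hi, e2⟩ := (SimpleGraph.Walk.mk_mem_edges_iff_exists _).1 he
      have key : ∀ x y, x < c.length → y < c.length →
          (c.getVert x = c.getVert y → x = y) := fun x y hx hy hxy =>
        inj (by simp; omega) (by simp; omega) hxy
      have hlast : c.getVert c.length = c.getVert 0 := by simp
      by_cases hi1 : i + 1 = c.length
      · rw [hi1, hlast] at e2
        rcases Sym2.eq_iff.1 e2 with ⟨h1, h2⟩ | ⟨h1, h2⟩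
        · have := key _ _ hi (by omega) h1
          have := key _ _ (by omega) hb h2
          omega
        · have := key _ _ hi hb h1
          have := key _ _ (by omega) (by omega) h2
          omega
      · rcases Sym2.eq_iff.1 e2 with ⟨h1, h2⟩ | ⟨h1, h2⟩
        · have := key _ _ hi (by omega) h1
          have := key _ _ (by omega) hb h2
          omega
        · have := key _ _ hi hb h1
          have := key _ _ (by omega) (by omega) h2
          omega
    · rintro (rfl | ⟨rfl, h⟩)
      · exact c.adj_getVert_succ (by omega)
      · have := c.adj_getVert_succ hb
        rw [h, c.getVert_length] at this
        simpa using this.symm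
  exact ⟨_, inducedCycle_of_window (by omega) hw⟩

/-! ### The combinatorics of zones: gates, counts and degrees. -/

open scoped Classical in
/-- `1` if the proposition holds, `0` otherwise. -/
noncomputable def ind (p : Prop) : ℕ := if p then 1 else 0

theorem ind_true {p : Prop} (h : p) : ind p = 1 := by simp [ind, h]

theorem ind_le_one (p : Prop) : ind p ≤ 1 := by
  simp only [ind]; split_ifs <;> simp

theorem ind_congr {p q : Prop} (h : p ↔ q) : ind p = ind q := by rw [propext h]

theorem ind_eq_zero {p : Prop} : ind p = 0 ↔ ¬ p := by simp [ind]

theorem ind_false {p : Prop} (h : ¬ p) : ind p = 0 := by simp [ind, h]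

/-- The zones `Z 0, …, Z (J - 1)` of a layer are grouped into boxes. The layer below is
`u 0, …, u (N - 1)`, with ancestors `an`, and the private zones of `u t` start at index `τ t`. -/
structure Boxes (G : SimpleGraph V) (N J : ℕ) (u : ℕ → V) (an : ℕ → List V)
    (Z : ℕ → Zone V) (τ : ℕ → ℕ) : Prop where
  zone_private : ∀ t < N, ∀ i z, (privateZones (u t) (an t))[i]? = some z →
    τ t + i < J ∧ Z (τ t + i) = z
  zone_shared : ∀ t, t + 1 < N → τ t + (privateZones (u t) (an t)).length < J ∧
    Z (τ t + (privateZones (u t) (an t)).length) = zoneEE (u t) (u (t + 1)) ∧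
    τ (t + 1) = τ t + (privateZones (u t) (an t)).length + 1
  start_zero : τ 0 = 0
  last : ∀ t, t + 1 = N → J = τ t + (privateZones (u t) (an t)).length
  local_center : ∀ t < N, ∀ j < J, u t ∈ (Z j).centers →
    τ t ≤ j + 1 ∧ j ≤ τ t + (privateZones (u t) (an t)).length
  inj : ∀ s < N, ∀ t < N, u s = u t → s = t
  types : ∀ t < N, an t = [] ∨ (∃ v, an t = [v]) ∨ ∃ v w, an t = [v, w] ∧ G.Adj v w
  adj_ancestor : ∀ t < N, ∀ v ∈ an t, G.Adj (u t) v
  ancestor_ne : ∀ t < N, ∀ v ∈ an t, ∀ s < N, v ≠ u s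
  sparse : ∀ t, t + 1 < N → an t = [] ∨ an (t + 1) = []

/-- The trace of a vertex set `S` on a layer, seen through the zones of that layer. The zone `Z j`
contains `c j` marked vertices of `S`, and `g j` says that `S` contains the path between the last
marked vertex of `Z (j - 1)` and the first one of `Z j`. -/
structure Trace (G : SimpleGraph V) (S : Finset V) (N J : ℕ) (u : ℕ → V) (an : ℕ → List V)
    (Z : ℕ → Zone V) (τ : ℕ → ℕ) (g : ℕ → Prop) (c : ℕ → ℕ) : Prop
    extends Boxes G N J u an Z τ where
  gate_zero : ¬ g 0
  gate_last : ¬ g J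
  pass : ∀ j < J, (∀ x ∈ (Z j).centers, x ∉ S) →
    (g j ↔ g (j + 1)) ∧ c j = ind (g j) * (Z j).size
  single : ∀ j < J, ∀ x ∈ (Z j).centers, x ∈ S → (∀ y ∈ (Z j).centers, y ∈ S → y = x) →
    c j = ind (g j) + ind (g (j + 1))
  double : ∀ j < J, ∀ x ∈ (Z j).centers, x ∈ S → ∀ y ∈ (Z j).centers, y ∈ S → y ≠ x →
    ¬ g j ∧ ¬ g (j + 1) ∧ c j = 0
  cross : ∀ j, j + 1 < J → ∀ x ∈ (Z j).centers, x ∈ (Z (j + 1)).centers → x ∈ S → ¬ g (j + 1)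
  cross_adj : ∀ j, j + 1 < J → (∀ x ∈ (Z j).centers, x ∉ (Z (j + 1)).centers) →
    ∀ x ∈ (Z j).centers, x ∈ S → ∀ y ∈ (Z (j + 1)).centers, y ∈ S → G.Adj x y → ¬ g (j + 1)
  skip : ∀ j, j + 2 < J → (∀ x ∈ (Z j).centers, x ∉ (Z (j + 1)).centers) →
    (∀ x ∈ (Z (j + 1)).centers, x ∉ (Z (j + 2)).centers) →
    (∀ x ∈ (Z (j + 1)).centers, x ∉ S) → (Z (j + 1)).size = 4 →
    ∀ x ∈ (Z j).centers, x ∈ (Z (j + 2)).centers → x ∈ S → ¬ g (j + 1)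

namespace Trace

open scoped Classical in
/-- The number of vertices of the trace in the top layer that are adjacent to `x`. -/
noncomputable def topDegree (J : ℕ) (Z : ℕ → Zone V) (c : ℕ → ℕ) (x : V) : ℕ :=
  ∑ j ∈ Finset.range J, if x ∈ (Z j).centers then c j else 0

open scoped Classical in
/-- The number of vertices of `S` below the top layer that are adjacent to `u t`. -/
noncomputable def lowDegree (S : Finset V) (N : ℕ) (u : ℕ → V) (an : ℕ → List V) (t : ℕ) : ℕ :=
  (if 0 < t then ind (u (t - 1) ∈ S) else 0) + (if t + 1 < N then ind (u (t + 1) ∈ S) else 0) +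
    ((an t).map (fun v => ind (v ∈ S))).sum

variable {S : Finset V} {N J : ℕ} {u : ℕ → V} {an : ℕ → List V}
    {Z : ℕ → Zone V} {τ : ℕ → ℕ} {g : ℕ → Prop} {c : ℕ → ℕ}

theorem start_pos (H : Trace G S N J u an Z τ g c) {t : ℕ} (ht : t < N) (h0 : 0 < t) :
    τ t - 1 + 1 = τ t ∧ τ t - 1 < J ∧ Z (τ t - 1) = zoneEE (u (t - 1)) (u t) ∧
      τ t - 1 = τ (t - 1) + (privateZones (u (t - 1)) (an (t - 1))).length := by
  obtain ⟨s, rfl⟩ : ∃ s, t = s + 1 := ⟨t - 1, by omega⟩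
  obtain ⟨h1, h2, h3⟩ := H.zone_shared s ht
  simp only [Nat.add_sub_cancel, h3]
  exact ⟨trivial, h1, h2, trivial⟩

open scoped Classical in
-- By `local_center`, only the zones of the box of `u t` can have it as a centre, so the sum over
-- all zones reduces to the private ones and the two shared ones.
theorem topDegree_eq (H : Trace G S N J u an Z τ g c) {t : ℕ} (ht : t < N) :
    topDegree J Z c (u t) = (if 0 < t then c (τ t - 1) else 0) +
      (∑ i ∈ Finset.range (privateZones (u t) (an t)).length,
        if u t ∈ (Z (τ t + i)).centers then c (τ t + i) else 0) +
      (if t + 1 < N then c (τ t + (privateZones (u t) (an t)).length) else 0) := by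
  set len := (privateZones (u t) (an t)).length with hlen
  set f : ℕ → ℕ := fun j => if u t ∈ (Z j).centers then c j else 0 with hf
  have hloc := H.local_center t ht
  have hJ : τ t + len ≤ J := by
    by_cases h : t + 1 < N
    · exact (H.zone_shared t h).1.le
    · exact (H.last t (by omega)).ge
  have e : J = τ t + len + (J - (τ t + len)) := by omega
  rw [topDegree, e, Finset.sum_range_add, Finset.sum_range_add]
  congr 1
  · congr 1
    split_ifs with h0
    · obtain ⟨h1, h2, h3, h4⟩ := H.start_pos ht h0
      have hm : τ t - 1 ∈ Finset.range (τ t) := Finset.mem_range.2 (by omega)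
      rw [Finset.sum_eq_single_of_mem _ hm]
      · rw [if_pos (by simp [h3, zoneEE])]
      · intro j hj hne
        rw [Finset.mem_range] at hj
        rw [if_neg]
        intro hc
        have := hloc j (by omega) hc
        omega
    · rw [show t = 0 by omega, H.start_zero]; simp
  · split_ifs with h0
    · obtain ⟨h1, h2, h3⟩ := H.zone_shared t h0
      rw [← hlen] at h1 h2
      have hm : 0 ∈ Finset.range (J - (τ t + len)) := Finset.mem_range.2 (by omega)
      rw [Finset.sum_eq_single_of_mem _ hm]
      · rw [if_pos (by simp [h2, zoneEE])]; simp
      · intro j hj hne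
        rw [Finset.mem_range] at hj
        rw [if_neg]
        intro hc
        have := hloc _ (by omega) hc
        omega
    · have := H.last t (by omega)
      rw [show J - (τ t + len) = 0 by omega]; simp

theorem zone_at (H : Trace G S N J u an Z τ g c) {t : ℕ} (ht : t < N) {A : List V} (hA : an t = A)
    (i : ℕ) {z : Zone V} (hz : (privateZones (u t) A)[i]? = some z) :
    τ t + i < J ∧ Z (τ t + i) = z :=
  H.zone_private t ht i z (by rw [hA]; exact hz)

theorem length_pos (H : Trace G S N J u an Z τ g c) {t : ℕ} (ht : t < N) :
    0 < (privateZones (u t) (an t)).length := by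
  rcases H.types t ht with h | ⟨v, h⟩ | ⟨v, w, h, _⟩ <;> rw [h] <;> simp [privateZones]

theorem mem_first (H : Trace G S N J u an Z τ g c) {t : ℕ} (ht : t < N) :
    τ t < J ∧ u t ∈ (Z (τ t)).centers := by
  rcases H.types t ht with h | ⟨v, h⟩ | ⟨v, w, h, _⟩
  all_goals
    obtain ⟨h1, h2⟩ := H.zone_at ht h 0 rfl
    rw [add_zero] at h1 h2
    exact ⟨h1, by simp [h2, zoneO, zoneE]⟩

theorem mem_last (H : Trace G S N J u an Z τ g c) {t : ℕ} (ht : t < N) :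
    u t ∈ (Z (τ t + ((privateZones (u t) (an t)).length - 1))).centers := by
  rcases H.types t ht with h | ⟨v, h⟩ | ⟨v, w, h, _⟩
  · rw [h, (H.zone_at ht h _ rfl).2]; simp [zoneO]
  · rw [h, (H.zone_at ht h _ rfl).2]; simp [zoneO]
  · rw [h, (H.zone_at ht h _ rfl).2]; simp [zoneE]

/-- There is no gate between the private zones of a vertex of `S` and the zones it shares. -/
theorem not_gate_of_mem (H : Trace G S N J u an Z τ g c) {t : ℕ} (ht : t < N) (hu : u t ∈ S) :
    ¬ g (τ t) ∧ ¬ g (τ t + (privateZones (u t) (an t)).length) := by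
  constructor
  · rcases Nat.eq_zero_or_pos t with h0 | h0
    · rw [h0, H.start_zero]; exact H.gate_zero
    · obtain ⟨h1, h2, h3, -⟩ := H.start_pos ht h0
      obtain ⟨h4, h5⟩ := H.mem_first ht
      rw [← h1] at h4 h5 ⊢
      exact H.cross _ h4 (u t) (by simp [h3, zoneEE]) h5 hu
  · by_cases h0 : t + 1 < N
    · obtain ⟨h1, h2, -⟩ := H.zone_shared t h0
      have h3 := H.length_pos ht
      have h4 := H.mem_last ht
      have e : τ t + (privateZones (u t) (an t)).length =
        τ t + ((privateZones (u t) (an t)).length - 1) + 1 := by omega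
      rw [e] at h1 h2 ⊢
      exact H.cross _ h1 (u t) h4 (by simp [h2, zoneEE]) hu
    · rw [← H.last t (by omega)]; exact H.gate_last

/-- If the left neighbour is on `S`, it is the only centre on `S` of the shared zone and its own
side of that zone has a closed gate, so only the end next to `u t` can count. If it is off `S`, the
zone is traversed entirely or not at all. -/
theorem left_of_notMem (H : Trace G S N J u an Z τ g c) {t : ℕ} (ht : t < N) (h0 : 0 < t)
    (hu : u t ∉ S) :
    (u (t - 1) ∉ S → (g (τ t - 1) ↔ g (τ t)) ∧ c (τ t - 1) = ind (g (τ t)) * 4) ∧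
    (u (t - 1) ∈ S → c (τ t - 1) = ind (g (τ t))) := by
  obtain ⟨h1, h2, h3, h4⟩ := H.start_pos ht h0
  constructor
  · intro hu'
    obtain ⟨h5, h6⟩ := H.pass _ h2 (by simp [h3, zoneEE, hu, hu'])
    rw [h1] at h5
    refine ⟨h5, ?_⟩
    rw [h6, h3, propext h5]; rfl
  · intro hu'
    have h5 := H.single _ h2 (u (t - 1)) (by simp [h3, zoneEE]) hu' (by simp [h3, zoneEE, hu])
    have h6 := (H.not_gate_of_mem (show t - 1 < N by omega) hu').2
    rw [← h4] at h6
    rw [h5, h1, ind_false h6, zero_add]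

theorem right_of_notMem (H : Trace G S N J u an Z τ g c) {t : ℕ} (ht : t + 1 < N)
    (hu : u t ∉ S) {j : ℕ} (hj : j = τ t + (privateZones (u t) (an t)).length) :
    (u (t + 1) ∉ S → (g j ↔ g (j + 1)) ∧ c j = ind (g j) * 4) ∧
    (u (t + 1) ∈ S → c j = ind (g j)) := by
  obtain ⟨h2, h3, h4⟩ := H.zone_shared t ht
  rw [← hj] at h2 h3 h4
  constructor
  · intro hu'
    obtain ⟨h5, h6⟩ := H.pass _ h2 (by simp [h3, zoneEE, hu, hu'])
    refine ⟨h5, ?_⟩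
    rw [h6, h3]; rfl
  · intro hu'
    have h5 := H.single _ h2 (u (t + 1)) (by simp [h3, zoneEE]) hu' (by simp [h3, zoneEE, hu])
    have h6 := (H.not_gate_of_mem ht hu').1
    rw [h4] at h6
    rw [h5, ind_false h6, add_zero]

theorem degree_type_zero (H : Trace G S N J u an Z τ g c) {t : ℕ} (ht : t < N) (ha : an t = []) :
    topDegree J Z c (u t) + lowDegree S N u an t =
      (if 0 < t then c (τ t - 1) + ind (u (t - 1) ∈ S) else 0) + c (τ t) +
      (if t + 1 < N then c (τ t + 1) + ind (u (t + 1) ∈ S) else 0) := by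
  have h1 := (H.mem_first ht).2
  rw [H.topDegree_eq ht, ha, lowDegree, ha]
  simp [privateZones, h1]
  split_ifs <;> omega

/-- A vertex without ancestors in the layer below the top one has no gate around its private zone. -/
theorem type_zero (H : Trace G S N J u an Z τ g c)
    (wheel : ∀ t < N, u t ∉ S → 3 ≤ topDegree J Z c (u t) →
      (topDegree J Z c (u t) + lowDegree S N u an t) % 2 = 0)
    {t : ℕ} (ht : t < N) (ha : an t = []) :
    c (τ t) = 0 ∧ ¬ g (τ t) ∧ ¬ g (τ t + 1) := by
  obtain ⟨hJ, hz⟩ := H.zone_at ht ha 0 rfl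
  rw [add_zero] at hJ hz
  by_cases hu : u t ∈ S
  · obtain ⟨h1, h2⟩ := H.not_gate_of_mem ht hu
    rw [ha] at h2
    change ¬ g (τ t + 1) at h2
    have h3 := H.single _ hJ (u t) (by simp [hz, zoneO]) hu (by simp [hz, zoneO])
    rw [ind_false h1, ind_false h2] at h3
    exact ⟨h3, h1, h2⟩
  obtain ⟨h1, h2⟩ := H.pass _ hJ (by simp [hz, zoneO, hu])
  rw [hz] at h2
  by_cases hg : g (τ t)
  swap
  · rw [ind_false hg, zero_mul] at h2
    exact ⟨h2, hg, fun h => hg (h1.2 h)⟩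
  exfalso
  have hg1 := h1.1 hg
  rw [ind_true hg] at h2
  simp only [zoneO] at h2
  have hw := wheel t ht hu
  rw [H.degree_type_zero ht ha] at hw
  have h3 : 3 ≤ topDegree J Z c (u t) := by
    rw [H.topDegree_eq ht, ha]
    simp [privateZones, hz, zoneO, h2]
    omega
  -- With the gate open, each existing side contributes `1 + 1` or `4 + 0` according to whether the
  -- neighbour is on `S`. The three vertices of the private zone then make the degree odd.
  have hL : ((if 0 < t then c (τ t - 1) + ind (u (t - 1) ∈ S) else 0) : ℕ) % 2 = 0 := by
    split_ifs with h0
    · by_cases hu' : u (t - 1) ∈ S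
      · rw [(H.left_of_notMem ht h0 hu).2 hu', ind_true hg, ind_true hu']
      · rw [((H.left_of_notMem ht h0 hu).1 hu').2, ind_true hg, ind_false hu']
    · rfl
  have hR : ((if t + 1 < N then c (τ t + 1) + ind (u (t + 1) ∈ S) else 0) : ℕ) % 2 = 0 := by
    split_ifs with h0
    · have hr := H.right_of_notMem h0 hu (j := τ t + 1) (by rw [ha]; rfl)
      by_cases hu' : u (t + 1) ∈ S
      · rw [hr.2 hu', ind_true hg1, ind_true hu']
      · rw [(hr.1 hu').2, ind_true hg1, ind_false hu']
    · rfl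
  have := hw h3
  omega

/-- The left neighbour has no ancestors, so its private zone is empty and has closed gates. If it is
off `S`, the shared zone therefore contributes nothing. If it is on `S`, its degree two must be
split between its two sides; the far side gives at most one, so the near side gives exactly one and
the gate is open. -/
theorem left_eq (H : Trace G S N J u an Z τ g c)
    (wheel : ∀ t < N, u t ∉ S → 3 ≤ topDegree J Z c (u t) →
      (topDegree J Z c (u t) + lowDegree S N u an t) % 2 = 0)
    (regular : ∀ t < N, u t ∈ S → topDegree J Z c (u t) + lowDegree S N u an t = 2)
    {t : ℕ} (ht : t < N) (ha : an t ≠ []) (hu : u t ∉ S) :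
    (if 0 < t then c (τ t - 1) + ind (u (t - 1) ∈ S) else 0) = 2 * ind (g (τ t)) := by
  split_ifs with h0
  swap
  · rw [show t = 0 by omega, H.start_zero, ind_false H.gate_zero]
  obtain ⟨h1, h2, h3, h4⟩ := H.start_pos ht h0
  have ht' : t - 1 < N := by omega
  have hN : t - 1 + 1 = t := by omega
  have ha' : an (t - 1) = [] := (H.sparse (t - 1) (by omega)).resolve_right (by rwa [hN])
  obtain ⟨c0, g0, g1⟩ := H.type_zero wheel ht' ha'
  have hl := H.left_of_notMem ht h0 hu
  have e : τ t - 1 = τ (t - 1) + 1 := by rw [h4, ha']; rfl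
  by_cases hu' : u (t - 1) ∈ S
  · have hr := regular _ ht' hu'
    rw [H.degree_type_zero ht' ha', c0, ← e, hN, if_pos ht, ind_false hu] at hr
    rw [hl.2 hu', ind_true hu'] at *
    have hle : (if 0 < t - 1 then c (τ (t - 1) - 1) + ind (u (t - 1 - 1) ∈ S) else 0) ≤ 1 := by
      split_ifs with h0'
      · obtain ⟨h5, h6, h7, -⟩ := H.start_pos ht' h0'
        by_cases hu'' : u (t - 1 - 1) ∈ S
        · have hne : u (t - 1 - 1) ≠ u (t - 1) := fun h => by
            have := H.inj _ (by omega) _ ht' h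
            omega
          rw [(H.double _ h6 (u (t - 1)) (by simp [h7, zoneEE]) hu' (u (t - 1 - 1))
            (by simp [h7, zoneEE]) hu'' hne).2.2, ind_true hu'']
        · rw [H.single _ h6 (u (t - 1)) (by simp [h7, zoneEE]) hu' (by simp [h7, zoneEE, hu'']), h5,
            ind_false g0, ind_false hu'']
          simp only [ind]; split_ifs <;> simp
      · simp
    by_cases hg : g (τ t)
    · rw [ind_true hg]
    · rw [ind_false hg] at hr
      omega
  · obtain ⟨h5, h6⟩ := hl.1 hu'
    have hg : ¬ g (τ t) := fun h => g1 (by rw [← e]; exact h5.2 h)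
    rw [h6, ind_false hg, ind_false hu']

theorem right_eq (H : Trace G S N J u an Z τ g c)
    (wheel : ∀ t < N, u t ∉ S → 3 ≤ topDegree J Z c (u t) →
      (topDegree J Z c (u t) + lowDegree S N u an t) % 2 = 0)
    (regular : ∀ t < N, u t ∈ S → topDegree J Z c (u t) + lowDegree S N u an t = 2)
    {t : ℕ} (ht : t < N) (ha : an t ≠ []) (hu : u t ∉ S) {j : ℕ}
    (hj : j = τ t + (privateZones (u t) (an t)).length) :
    (if t + 1 < N then c j + ind (u (t + 1) ∈ S) else 0) = 2 * ind (g j) := by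
  split_ifs with h0
  swap
  · rw [hj, ← H.last t (by omega), ind_false H.gate_last]
  obtain ⟨h2, h3, h4⟩ := H.zone_shared t h0
  rw [← hj] at h2 h3 h4
  have ha' : an (t + 1) = [] := (H.sparse t h0).resolve_left ha
  obtain ⟨c0, g0, g1⟩ := H.type_zero wheel h0 ha'
  have hl := H.right_of_notMem h0 hu hj
  by_cases hu' : u (t + 1) ∈ S
  · have hr := regular _ h0 hu'
    rw [H.degree_type_zero h0 ha', c0, if_pos (by omega), Nat.add_sub_cancel, h4,
      Nat.add_sub_cancel, ind_false hu] at hr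
    rw [hl.2 hu', ind_true hu'] at *
    have hle : (if t + 1 + 1 < N then c (j + 1 + 1) + ind (u (t + 1 + 1) ∈ S) else 0) ≤ 1 := by
      split_ifs with h0'
      · obtain ⟨h6, h7, -⟩ := H.zone_shared (t + 1) h0'
        rw [ha', h4] at h6 h7
        change j + 1 + 1 < J at h6
        change Z (j + 1 + 1) = _ at h7
        rw [h4] at g1
        by_cases hu'' : u (t + 1 + 1) ∈ S
        · have hne : u (t + 1 + 1) ≠ u (t + 1) := fun h => by
            have := H.inj _ h0' _ h0 h
            omega
          rw [(H.double _ h6 (u (t + 1)) (by simp [h7, zoneEE]) hu' (u (t + 1 + 1))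
            (by simp [h7, zoneEE]) hu'' hne).2.2, ind_true hu'']
        · rw [H.single _ h6 (u (t + 1)) (by simp [h7, zoneEE]) hu' (by simp [h7, zoneEE, hu'']),
            ind_false g1, ind_false hu'']
          simp only [ind]; split_ifs <;> simp
      · simp
    by_cases hg : g j
    · rw [ind_true hg]
    · rw [ind_false hg] at hr
      omega
  · obtain ⟨h5, h6⟩ := hl.1 hu'
    have hg : ¬ g j := fun h => g0 (by rw [h4]; exact h5.1 h)
    rw [h6, ind_false hg, ind_false hu']

theorem degree_type_one (H : Trace G S N J u an Z τ g c) {t : ℕ} (ht : t < N) {v : V}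
    (ha : an t = [v]) :
    topDegree J Z c (u t) + lowDegree S N u an t =
      (if 0 < t then c (τ t - 1) + ind (u (t - 1) ∈ S) else 0) +
      (c (τ t) + c (τ t + 1) + c (τ t + 2)) + ind (v ∈ S) +
      (if t + 1 < N then c (τ t + 3) + ind (u (t + 1) ∈ S) else 0) := by
  have z0 := (H.zone_at ht ha 0 rfl).2
  have z1 := (H.zone_at ht ha 1 rfl).2
  have z2 := (H.zone_at ht ha 2 rfl).2
  rw [add_zero] at z0
  rw [H.topDegree_eq ht, ha, lowDegree, ha]
  simp [privateZones, Finset.sum_range_succ, z0, z1, z2, zoneO, zoneOO]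
  split_ifs <;> omega

/-- For `u t` on `S` all the zones involved share the centre `u t`, so no gate is open. Off `S`, an
open gate would make the degree odd, with at least three neighbours in the top layer. -/
theorem type_one (H : Trace G S N J u an Z τ g c)
    (wheel : ∀ t < N, u t ∉ S → 3 ≤ topDegree J Z c (u t) →
      (topDegree J Z c (u t) + lowDegree S N u an t) % 2 = 0)
    (regular : ∀ t < N, u t ∈ S → topDegree J Z c (u t) + lowDegree S N u an t = 2)
    {t : ℕ} (ht : t < N) {v : V} (ha : an t = [v]) : ∀ i ≤ 3, ¬ g (τ t + i) := by
  obtain ⟨j0, z0⟩ := H.zone_at ht ha 0 rfl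
  obtain ⟨j1, z1⟩ := H.zone_at ht ha 1 rfl
  obtain ⟨j2, z2⟩ := H.zone_at ht ha 2 rfl
  rw [add_zero] at j0 z0
  suffices h : ¬ g (τ t) ∧ ¬ g (τ t + 1) ∧ ¬ g (τ t + 2) ∧ ¬ g (τ t + 3) by
    intro i hi
    interval_cases i <;> tauto
  by_cases hu : u t ∈ S
  · obtain ⟨h1, h2⟩ := H.not_gate_of_mem ht hu
    rw [ha] at h2
    exact ⟨h1, H.cross _ j1 (u t) (by simp [z0, zoneO]) (by simp [z1, zoneOO]) hu,
      H.cross _ j2 (u t) (by simp [z1, zoneOO]) (by simp [z2, zoneO]) hu, h2⟩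
  have hne : an t ≠ [] := by simp [ha]
  have hL := H.left_eq wheel regular ht hne hu
  have hR := H.right_eq wheel regular ht hne hu (j := τ t + 3) (by rw [ha]; rfl)
  obtain ⟨h0, c0⟩ := H.pass _ j0 (by simp [z0, zoneO, hu])
  obtain ⟨h2, c2⟩ := H.pass _ j2 (by simp [z2, zoneO, hu])
  rw [z0] at c0
  rw [z2] at c2
  simp only [zoneO] at c0 c2
  have hw := wheel t ht hu
  have htop : c (τ t) + c (τ t + 2) ≤ topDegree J Z c (u t) := by
    rw [H.topDegree_eq ht, ha]
    simp [privateZones, Finset.sum_range_succ, z0, z2, zoneO]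
    omega
  rw [H.degree_type_one ht ha, hL, hR] at hw
  -- Gates become 0/1 numbers, so that the rest is linear arithmetic.
  simp only [← ind_eq_zero]
  replace h0 := ind_congr h0
  replace h2 := ind_congr h2
  have l0 := ind_le_one (g (τ t))
  have l2 := ind_le_one (g (τ t + 2))
  by_cases hv : v ∈ S
  -- Writing `gᵢ` for the gate at `τ t + i`, the total degree is `6 (g₀ + g₂) + 1`.
  · have c1 := H.single _ j1 v (by simp [z1, zoneOO]) hv (by simp [z1, zoneOO, hu])
    rw [ind_true hv] at hw
    clear H wheel regular
    simp only [Nat.add_assoc, Nat.reduceAdd] at *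
    omega
  -- All gates are equal here and the total degree is `13 g₀`.
  · obtain ⟨h1, c1⟩ := H.pass _ j1 (by simp [z1, zoneOO, hu, hv])
    rw [z1] at c1
    simp only [zoneOO] at c1
    replace h1 := ind_congr h1
    rw [ind_false hv] at hw
    clear H wheel regular
    simp only [Nat.add_assoc, Nat.reduceAdd] at *
    omega

theorem degree_type_two (H : Trace G S N J u an Z τ g c) {t : ℕ} (ht : t < N) {v w : V}
    (ha : an t = [v, w]) :
    topDegree J Z c (u t) + lowDegree S N u an t =
      (if 0 < t then c (τ t - 1) + ind (u (t - 1) ∈ S) else 0) +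
      (c (τ t) + c (τ t + 2) + c (τ t + 3) + c (τ t + 4) + c (τ t + 5) + c (τ t + 6) +
        c (τ t + 8)) + (ind (v ∈ S) + ind (w ∈ S)) +
      (if t + 1 < N then c (τ t + 9) + ind (u (t + 1) ∈ S) else 0) := by
  have z0 := (H.zone_at ht ha 0 rfl).2
  have z1 := (H.zone_at ht ha 1 rfl).2
  have z2 := (H.zone_at ht ha 2 rfl).2
  have z3 := (H.zone_at ht ha 3 rfl).2
  have z4 := (H.zone_at ht ha 4 rfl).2
  have z5 := (H.zone_at ht ha 5 rfl).2
  have z6 := (H.zone_at ht ha 6 rfl).2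
  have z7 := (H.zone_at ht ha 7 rfl).2
  have z8 := (H.zone_at ht ha 8 rfl).2
  have hv : u t ≠ v := (H.ancestor_ne t ht v (by simp [ha]) t ht).symm
  have hw : u t ≠ w := (H.ancestor_ne t ht w (by simp [ha]) t ht).symm
  rw [add_zero] at z0
  rw [H.topDegree_eq ht, ha, lowDegree, ha]
  simp [privateZones, Finset.sum_range_succ, z0, z1, z2, z3, z4, z5, z6, z7, z8, zoneO, zoneOO,
    zoneE, zoneEE, hv, hw]
  split_ifs <;> omega

/-- The same parity obstruction when `u t` is off `S`, for each of the four possible traces of `S`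
on its two ancestors. When `u t` is on `S`, the zones without centre `u t` need a separate argument.
-/
theorem type_two (H : Trace G S N J u an Z τ g c)
    (wheel : ∀ t < N, u t ∉ S → 3 ≤ topDegree J Z c (u t) →
      (topDegree J Z c (u t) + lowDegree S N u an t) % 2 = 0)
    (regular : ∀ t < N, u t ∈ S → topDegree J Z c (u t) + lowDegree S N u an t = 2)
    {t : ℕ} (ht : t < N) {v w : V} (ha : an t = [v, w]) : ∀ i ≤ 9, ¬ g (τ t + i) := by
  obtain ⟨j0, z0⟩ := H.zone_at ht ha 0 rfl
  obtain ⟨j1, z1⟩ := H.zone_at ht ha 1 rfl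
  obtain ⟨j2, z2⟩ := H.zone_at ht ha 2 rfl
  obtain ⟨j3, z3⟩ := H.zone_at ht ha 3 rfl
  obtain ⟨j4, z4⟩ := H.zone_at ht ha 4 rfl
  obtain ⟨j5, z5⟩ := H.zone_at ht ha 5 rfl
  obtain ⟨j6, z6⟩ := H.zone_at ht ha 6 rfl
  obtain ⟨j7, z7⟩ := H.zone_at ht ha 7 rfl
  obtain ⟨j8, z8⟩ := H.zone_at ht ha 8 rfl
  rw [add_zero] at j0 z0
  have hvw : v ≠ w := by
    rcases H.types t ht with h | ⟨v', h⟩ | ⟨v', w', h, h'⟩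
    · simp [ha] at h
    · simp [ha] at h
    · rw [ha] at h
      simp only [List.cons.injEq, and_true] at h
      rw [h.1, h.2]
      exact h'.ne
  have huv : u t ≠ v := (H.ancestor_ne t ht v (by simp [ha]) t ht).symm
  have huw : u t ≠ w := (H.ancestor_ne t ht w (by simp [ha]) t ht).symm
  have auv : G.Adj (u t) v := H.adj_ancestor t ht v (by simp [ha])
  have auw : G.Adj (u t) w := H.adj_ancestor t ht w (by simp [ha])
  suffices h : ¬ g (τ t) ∧ ¬ g (τ t + 1) ∧ ¬ g (τ t + 2) ∧ ¬ g (τ t + 3) ∧ ¬ g (τ t + 4) ∧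
      ¬ g (τ t + 5) ∧ ¬ g (τ t + 6) ∧ ¬ g (τ t + 7) ∧ ¬ g (τ t + 8) ∧ ¬ g (τ t + 9) by
    intro i hi
    interval_cases i <;> tauto
  by_cases hu : u t ∈ S
  · obtain ⟨h1, h2⟩ := H.not_gate_of_mem ht hu
    rw [ha] at h2
    -- Around a zone `E_{v,w}`: if `v` or `w` is on `S`, an open gate closes up through the edge
    -- from it to `u t`; if neither is, `S` would traverse the zone and close up through `u t`
    -- itself.
    have key : ∀ j, j + 2 < J → u t ∈ (Z j).centers → u t ∈ (Z (j + 2)).centers →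
        (∀ x ∈ (Z j).centers, x = u t) → (∀ x ∈ (Z (j + 2)).centers, x = u t) →
        Z (j + 1) = zoneEE v w → ¬ g (j + 1) ∧ ¬ g (j + 2) := by
      intro j hj m0 m2 o0 o2 e1
      have d0 : ∀ x ∈ (Z j).centers, x ∉ (Z (j + 1)).centers := by
        intro x hx
        rw [o0 x hx]
        simp [e1, zoneEE, huv, huw]
      have d2 : ∀ x ∈ (Z (j + 1)).centers, x ∉ (Z (j + 2)).centers := by
        intro x hx hx2
        rw [o2 x hx2] at hx
        simp [e1, zoneEE, huv, huw] at hx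
      have mv : v ∈ (Z (j + 1)).centers := by simp [e1, zoneEE]
      have mw : w ∈ (Z (j + 1)).centers := by simp [e1, zoneEE]
      by_cases hv : v ∈ S
      · exact ⟨H.cross_adj j (by omega) d0 _ m0 hu v mv hv auv,
          H.cross_adj (j + 1) (by omega) d2 v mv hv _ m2 hu auv.symm⟩
      by_cases hw : w ∈ S
      · exact ⟨H.cross_adj j (by omega) d0 _ m0 hu w mw hw auw,
          H.cross_adj (j + 1) (by omega) d2 w mw hw _ m2 hu auw.symm⟩
      have hS : ∀ x ∈ (Z (j + 1)).centers, x ∉ S := by simp [e1, zoneEE, hv, hw]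
      have := H.skip j hj d0 d2 hS (by simp [e1, zoneEE]) _ m0 m2 hu
      exact ⟨this, fun h => this ((H.pass _ (by omega) hS).1.2 h)⟩
    obtain ⟨k1, k2⟩ := key (τ t) j2 (by simp [z0, zoneE]) (by simp [z2, zoneO])
      (by simp [z0, zoneE]) (by simp [z2, zoneO]) z1
    obtain ⟨k7, k8⟩ := key (τ t + 6) j8 (by simp [z6, zoneO]) (by simp [z8, zoneE])
      (by simp [z6, zoneO]) (by simp [z8, zoneE]) z7
    exact ⟨h1, k1, k2, H.cross _ j3 (u t) (by simp [z2, zoneO]) (by simp [z3, zoneOO]) hu,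
      H.cross _ j4 (u t) (by simp [z3, zoneOO]) (by simp [z4, zoneO]) hu,
      H.cross _ j5 (u t) (by simp [z4, zoneO]) (by simp [z5, zoneOO]) hu,
      H.cross _ j6 (u t) (by simp [z5, zoneOO]) (by simp [z6, zoneO]) hu, k7, k8, h2⟩
  have hne : an t ≠ [] := by simp [ha]
  have hL := H.left_eq wheel regular ht hne hu
  have hR := H.right_eq wheel regular ht hne hu (j := τ t + 9) (by rw [ha]; rfl)
  obtain ⟨h0, c0⟩ := H.pass _ j0 (by simp [z0, zoneE, hu])
  obtain ⟨h2, c2⟩ := H.pass _ j2 (by simp [z2, zoneO, hu])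
  obtain ⟨h4, c4⟩ := H.pass _ j4 (by simp [z4, zoneO, hu])
  obtain ⟨h6, c6⟩ := H.pass _ j6 (by simp [z6, zoneO, hu])
  obtain ⟨h8, c8⟩ := H.pass _ j8 (by simp [z8, zoneE, hu])
  rw [z0] at c0
  rw [z2] at c2
  rw [z4] at c4
  rw [z6] at c6
  rw [z8] at c8
  have hw := wheel t ht hu
  have htop : c (τ t) + c (τ t + 2) + c (τ t + 4) + c (τ t + 6) + c (τ t + 8) ≤
      topDegree J Z c (u t) := by
    rw [H.topDegree_eq ht, ha]
    simp [privateZones, Finset.sum_range_succ, z0, z2, z4, z6, z8, zoneO, zoneE]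
    omega
  rw [H.degree_type_two ht ha, hL, hR] at hw
  simp only [← ind_eq_zero]
  replace h0 := ind_congr h0
  replace h2 := ind_congr h2
  replace h4 := ind_congr h4
  replace h6 := ind_congr h6
  replace h8 := ind_congr h8
  have l0 := ind_le_one (g (τ t))
  have l2 := ind_le_one (g (τ t + 2))
  have l4 := ind_le_one (g (τ t + 4))
  have l6 := ind_le_one (g (τ t + 6))
  have l8 := ind_le_one (g (τ t + 8))
  simp only [zoneE, zoneO] at c0 c2 c4 c6 c8
  by_cases hv : v ∈ S <;> by_cases hwS : w ∈ S
  -- Only the gates `g₄ = g₅` can be open; the total degree is `5 g₄ + 2`.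
  · obtain ⟨g1, g2, -⟩ := H.double _ j1 v (by simp [z1, zoneEE]) hv w (by simp [z1, zoneEE]) hwS
      hvw.symm
    obtain ⟨g7, g8, -⟩ := H.double _ j7 v (by simp [z7, zoneEE]) hv w (by simp [z7, zoneEE]) hwS
      hvw.symm
    have c3 := H.single _ j3 v (by simp [z3, zoneOO]) hv (by simp [z3, zoneOO, hu])
    have c5 := H.single _ j5 w (by simp [z5, zoneOO]) hwS (by simp [z5, zoneOO, hu])
    rw [← ind_eq_zero] at g1 g2 g7 g8
    rw [ind_true hv, ind_true hwS] at hw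
    clear H wheel regular
    simp only [Nat.add_assoc, Nat.reduceAdd] at *
    omega
  -- The total degree is `6 g₀ + 4 g₂ + 10 g₄ + 6 g₈ + 1`; the next case is its mirror image.
  · have c1 := H.single _ j1 v (by simp [z1, zoneEE]) hv (by simp [z1, zoneEE, hwS])
    have c7 := H.single _ j7 v (by simp [z7, zoneEE]) hv (by simp [z7, zoneEE, hwS])
    have c3 := H.single _ j3 v (by simp [z3, zoneOO]) hv (by simp [z3, zoneOO, hu])
    obtain ⟨h5, c5⟩ := H.pass _ j5 (by simp [z5, zoneOO, hu, hwS])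
    rw [z5] at c5
    replace h5 := ind_congr h5
    simp only [zoneOO] at c5
    rw [ind_true hv, ind_false hwS] at hw
    clear H wheel regular
    simp only [Nat.add_assoc, Nat.reduceAdd] at *
    omega
  · have c1 := H.single _ j1 w (by simp [z1, zoneEE]) hwS (by simp [z1, zoneEE, hv])
    have c7 := H.single _ j7 w (by simp [z7, zoneEE]) hwS (by simp [z7, zoneEE, hv])
    have c5 := H.single _ j5 w (by simp [z5, zoneOO]) hwS (by simp [z5, zoneOO, hu])
    obtain ⟨h3, c3⟩ := H.pass _ j3 (by simp [z3, zoneOO, hu, hv])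
    rw [z3] at c3
    replace h3 := ind_congr h3
    simp only [zoneOO] at c3
    rw [ind_false hv, ind_true hwS] at hw
    clear H wheel regular
    simp only [Nat.add_assoc, Nat.reduceAdd] at *
    omega
  -- All gates are equal and the total degree is `27 g₀`.
  · obtain ⟨h1, c1⟩ := H.pass _ j1 (by simp [z1, zoneEE, hv, hwS])
    obtain ⟨h3, c3⟩ := H.pass _ j3 (by simp [z3, zoneOO, hu, hv])
    obtain ⟨h5, c5⟩ := H.pass _ j5 (by simp [z5, zoneOO, hu, hwS])
    obtain ⟨h7, c7⟩ := H.pass _ j7 (by simp [z7, zoneEE, hv, hwS])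
    rw [z3] at c3
    rw [z5] at c5
    replace h1 := ind_congr h1
    replace h3 := ind_congr h3
    replace h5 := ind_congr h5
    replace h7 := ind_congr h7
    simp only [zoneOO] at c3 c5
    rw [ind_false hv, ind_false hwS] at hw
    clear H wheel regular
    simp only [Nat.add_assoc, Nat.reduceAdd] at *
    omega

/-- A trace has no gate at all. -/
theorem not_gate (H : Trace G S N J u an Z τ g c)
    (wheel : ∀ t < N, u t ∉ S → 3 ≤ topDegree J Z c (u t) →
      (topDegree J Z c (u t) + lowDegree S N u an t) % 2 = 0)
    (regular : ∀ t < N, u t ∈ S → topDegree J Z c (u t) + lowDegree S N u an t = 2)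
    {t : ℕ} (ht : t < N) :
    ∀ j ≤ τ t + (privateZones (u t) (an t)).length, ¬ g j := by
  have box : ∀ t < N, ∀ i ≤ (privateZones (u t) (an t)).length, ¬ g (τ t + i) := by
    intro t ht
    rcases H.types t ht with h | ⟨v, h⟩ | ⟨v, w, h, -⟩
    · rw [h]
      intro i hi
      change i ≤ 1 at hi
      obtain ⟨-, h1, h2⟩ := H.type_zero wheel ht h
      interval_cases i
      · exact h1
      · exact h2
    · rw [h]; exact H.type_one wheel regular ht h
    · rw [h]; exact H.type_two wheel regular ht h
  induction t with
  | zero =>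
    intro j hj
    have := box 0 ht j (by rw [H.start_zero] at hj; omega)
    rwa [H.start_zero, zero_add] at this
  | succ t ih =>
    intro j hj
    by_cases h : j ≤ τ t + (privateZones (u t) (an t)).length
    · exact ih (by omega) j h
    · have h3 := (H.zone_shared t ht).2.2
      have := box (t + 1) ht (j - τ (t + 1)) (by omega)
      rwa [show τ (t + 1) + (j - τ (t + 1)) = j by omega] at this

/-- A trace is empty. -/
theorem count_eq_zero (H : Trace G S N J u an Z τ g c) (hN : 0 < N)
    (wheel : ∀ t < N, u t ∉ S → 3 ≤ topDegree J Z c (u t) →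
      (topDegree J Z c (u t) + lowDegree S N u an t) % 2 = 0)
    (regular : ∀ t < N, u t ∈ S → topDegree J Z c (u t) + lowDegree S N u an t = 2)
    {j : ℕ} (hj : j < J) : c j = 0 := by
  have hlast := H.last (N - 1) (by omega)
  have hg := H.not_gate wheel regular (show N - 1 < N by omega)
  rw [← hlast] at hg
  have g0 := hg j hj.le
  have g1 := hg (j + 1) hj
  by_cases h : ∃ x ∈ (Z j).centers, x ∈ S
  · obtain ⟨x, hx, hxS⟩ := h
    by_cases h' : ∃ y ∈ (Z j).centers, y ∈ S ∧ y ≠ x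
    · obtain ⟨y, hy, hyS, hne⟩ := h'
      exact (H.double j hj x hx hxS y hy hyS hne).2.2
    · push Not at h'
      rw [H.single j hj x hx hxS h', ind_false g0, ind_false g1]
  · push Not at h
    rw [(H.pass j hj h).2, ind_false g0, zero_mul]

end Trace

/-! ### How an induced cycle meets its top layer. -/

namespace InducedCycle

variable {n : ℕ} {F : ℕ → V}

theorem exists_neighbors (hF : InducedCycle G n F) {x : V} (hx : x ∈ verts n F) :
    ∃ y ∈ verts n F, ∃ z ∈ verts n F, y ≠ z ∧ G.Adj x y ∧ G.Adj x z ∧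
      ∀ w ∈ verts n F, G.Adj x w → w = y ∨ w = z := by
  obtain ⟨a, rfl⟩ := hF.mem_verts.1 hx
  refine ⟨_, hF.mem_verts.2 ⟨a + 1, rfl⟩, _, hF.mem_verts.2 ⟨a + (n - 1), rfl⟩, hF.succ_ne_pred a,
    hF.adj_succ a, hF.adj_pred a, fun w hw h => ?_⟩
  obtain ⟨b, rfl⟩ := hF.mem_verts.1 hw
  exact hF.eq_or_eq_of_adj h

theorem eq_of_adj_three (hF : InducedCycle G n F) {x y z w : V} (hx : x ∈ verts n F)
    (hy : y ∈ verts n F) (hz : z ∈ verts n F) (hw : w ∈ verts n F) (hxy : G.Adj x y)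
    (hxz : G.Adj x z) (hxw : G.Adj x w) (hyz : y ≠ z) : w = y ∨ w = z := by
  obtain ⟨b, -, c, -, -, -, -, h⟩ := hF.exists_neighbors hx
  have h1 := h y hy hxy
  have h2 := h z hz hxz
  have h3 := h w hw hxw
  grind

/-- Both cycle neighbours of a vertex of `T` already lie in `T`, so `T` is closed. This computes the
length of a cycle as soon as a closed circuit is recognised inside it. -/
theorem eq_verts_of_two_neighbors (hF : InducedCycle G n F) {T : Finset V} (hT : T ⊆ verts n F)
    (hne : T.Nonempty) (h : ∀ x ∈ T, ∃ y ∈ T, ∃ z ∈ T, y ≠ z ∧ G.Adj x y ∧ G.Adj x z) :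
    T.card = n := by
  rw [hF.eq_verts_of_closed hT hne, hF.card_verts]
  intro x hx w hw hxw
  obtain ⟨y, hy, z, hz, hyz, hxy, hxz⟩ := h x hx
  rcases hF.eq_of_adj_three (hT hx) (hT hy) (hT hz) hw hxy hxz hxw hyz with rfl | rfl
  · exact hy
  · exact hz

end InducedCycle

open InducedCycle

/-- A path `p 0, …, p (N - 1)` of `G` that is the top layer for the vertex set `S`: every vertex of
`S` adjacent to `p a` lies on the path or is one of the ancestors `A (p a)`. The positions of the
vertices with ancestors are `μ 0 < … < μ (M - 1)`. -/
structure TopLayer (G : SimpleGraph V) (S : Finset V) (k N M : ℕ) (p : ℕ → V) (A : V → List V)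
    (μ : ℕ → ℕ) : Prop where
  inj : ∀ a < N, ∀ b < N, p a = p b → a = b
  adj : ∀ a < N, ∀ b < N, (G.Adj (p a) (p b) ↔ a + 1 = b ∨ b + 1 = a)
  neighbor : ∀ a < N, ∀ y ∈ S, G.Adj (p a) y → (∃ b < N, y = p b) ∨ y ∈ A (p a)
  adj_ancestor : ∀ a < N, ∀ y ∈ A (p a), G.Adj (p a) y
  ancestor_ne : ∀ a < N, ∀ y ∈ A (p a), ∀ b < N, y ≠ p b
  types : ∀ a < N, A (p a) = [] ∨ (∃ v, A (p a) = [v]) ∨ ∃ v w, A (p a) = [v, w] ∧ G.Adj v w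
  pos_lt : ∀ m < M, μ m < N
  pos_lt_pos : ∀ m, m + 1 < M → μ m < μ (m + 1)
  marked : ∀ m < M, A (p (μ m)) ≠ []
  exists_pos : ∀ a < N, A (p a) ≠ [] → ∃ m < M, μ m = a
  unmarked : ∀ m, m + 1 < M → ∀ a, μ m < a → a < μ (m + 1) → A (p a) = []
  first : 0 < N → A (p 0) ≠ []
  final : 0 < N → A (p (N - 1)) ≠ []
  four_le : 4 ≤ k
  gap : ∀ m, m + 1 < M → k ≤ μ (m + 1) - μ m + 2
  gap_odd : ∀ m, m + 1 < M → ∀ x ∈ A (p (μ m)), x ∈ A (p (μ (m + 1))) → Odd (μ (m + 1) - μ m)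
  gap_even : ∀ m, m + 1 < M → (∀ x ∈ A (p (μ m)), x ∉ A (p (μ (m + 1)))) →
    Even (μ (m + 1) - μ m)

/-- `S` contains the path between the marked vertices of indices `m - 1` and `m`. -/
def Edge (S : Finset V) (M : ℕ) (p : ℕ → V) (μ : ℕ → ℕ) (m : ℕ) : Prop :=
  0 < m ∧ m < M ∧ ∀ a, μ (m - 1) ≤ a → a ≤ μ m → p a ∈ S

namespace TopLayer

variable {n k N M : ℕ} {F : ℕ → V} {p : ℕ → V} {A : V → List V} {μ : ℕ → ℕ}

theorem gap_two (H : TopLayer G (verts n F) k N M p A μ) {m : ℕ} (hm : m + 1 < M) :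
    μ m + 2 ≤ μ (m + 1) := by
  have := H.gap m hm
  have := H.four_le
  omega

theorem of_unmarked (H : TopLayer G (verts n F) k N M p A μ) (hF : InducedCycle G n F) {a : ℕ}
    (ha : a < N) (hA : A (p a) = []) (hS : p a ∈ verts n F) :
    0 < a ∧ a + 1 < N ∧ p (a - 1) ∈ verts n F ∧ p (a + 1) ∈ verts n F := by
  have h0 : 0 < a := by
    rcases Nat.eq_zero_or_pos a with rfl | h
    · exact absurd hA (H.first ha)
    · exact h
  have h1 : a + 1 < N := by
    by_contra h
    have : a = N - 1 := by omega
    subst this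
    exact H.final (by omega) hA
  have key : ∀ y ∈ verts n F, G.Adj (p a) y → y = p (a - 1) ∨ y = p (a + 1) := by
    intro y hy hay
    rcases H.neighbor a ha y hy hay with ⟨b, hb, rfl⟩ | h
    · rcases (H.adj a ha b hb).1 hay with h | h
      · right; rw [h]
      · left; rw [← h]; simp
    · simp [hA] at h
  obtain ⟨y, hy, z, hz, hyz, ay, az, -⟩ := hF.exists_neighbors hS
  refine ⟨h0, h1, ?_⟩
  rcases key y hy ay with rfl | rfl <;> rcases key z hz az with rfl | rfl
  · exact absurd rfl hyz
  · exact ⟨hy, hz⟩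
  · exact ⟨hz, hy⟩
  · exact absurd rfl hyz

/-- An unmarked vertex on the cycle has both of its path neighbours on the cycle, which spreads in
both directions up to the next marked vertices. -/
theorem edge_of_interior (H : TopLayer G (verts n F) k N M p A μ) (hF : InducedCycle G n F) {m : ℕ}
    (hm : m + 1 < M) {a : ℕ} (h1 : μ m < a) (h2 : a < μ (m + 1)) (ha : p a ∈ verts n F) :
    Edge (verts n F) M p μ (m + 1) := by
  have hlt := H.pos_lt _ hm
  have up : ∀ d, a + d ≤ μ (m + 1) → p (a + d) ∈ verts n F := by
    intro d
    induction d with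
    | zero => intro _; exact ha
    | succ d ih =>
      intro hd
      exact (H.of_unmarked hF (by omega) (H.unmarked m hm _ (by omega) (by omega))
        (ih (by omega))).2.2.2
  have down : ∀ d, μ m + d ≤ a → p (a - d) ∈ verts n F := by
    intro d
    induction d with
    | zero => intro _; exact ha
    | succ d ih =>
      intro hd
      exact (H.of_unmarked hF (by omega) (H.unmarked m hm _ (by omega) (by omega))
        (ih (by omega))).2.2.1
  refine ⟨by omega, hm, fun b hb1 hb2 => ?_⟩
  rw [Nat.add_sub_cancel] at hb1
  rcases le_total a b with h | h
  · have := up (b - a) (by omega)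
    rwa [show a + (b - a) = b by omega] at this
  · have := down (a - b) (by omega)
    rwa [show a - (a - b) = b by omega] at this

theorem edge_right (H : TopLayer G (verts n F) k N M p A μ) (hF : InducedCycle G n F) {m : ℕ}
    (hm : m < M) (h1 : μ m + 1 < N) (h : p (μ m + 1) ∈ verts n F) :
    Edge (verts n F) M p μ (m + 1) := by
  have hM : m + 1 < M := by
    by_contra hc
    -- The end of the path is marked, so beyond the last marked vertex there is nothing.
    obtain ⟨m', hm', e⟩ := H.exists_pos (N - 1) (by omega) (H.final (by omega))
    have : ∀ d, d + m' < M → μ m' ≤ μ (d + m') := by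
      intro d
      induction d with
      | zero => intro _; simp
      | succ d ih =>
        intro hd
        have := H.pos_lt_pos (d + m') (by omega)
        have := ih (by omega)
        rw [show d + 1 + m' = d + m' + 1 by omega]
        omega
    have := this (m - m') (by omega)
    rw [show m - m' + m' = m by omega] at this
    omega
  exact H.edge_of_interior hF hM (by omega) (by have := H.gap_two hM; omega) h

theorem edge_left (H : TopLayer G (verts n F) k N M p A μ) (hF : InducedCycle G n F) {m : ℕ}
    (hm : m < M) (h1 : 0 < μ m) (h : p (μ m - 1) ∈ verts n F) :
    Edge (verts n F) M p μ m := by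
  rcases Nat.eq_zero_or_pos m with rfl | h0
  · obtain ⟨m', hm', e⟩ := H.exists_pos 0 (by have := H.pos_lt 0 hm; omega)
      (H.first (by have := H.pos_lt 0 hm; omega))
    have : ∀ d < M, μ 0 ≤ μ d := by
      intro d
      induction d with
      | zero => intro _; simp
      | succ d ih =>
        intro hd
        have := H.pos_lt_pos d (by omega)
        have := ih (by omega)
        omega
    have := this m' hm'
    omega
  · obtain ⟨m, rfl⟩ : ∃ m', m = m' + 1 := ⟨m - 1, by omega⟩
    have := H.gap_two hm
    exact H.edge_of_interior hF hm (by omega) (by omega) h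

theorem mem_of_edge (H : TopLayer G (verts n F) k N M p A μ) {m : ℕ}
    (h : Edge (verts n F) M p μ m) : p (μ m) ∈ verts n F := by
  obtain ⟨m', rfl⟩ : ∃ m', m = m' + 1 := ⟨m - 1, by have := h.1; omega⟩
  exact h.2.2 _ (H.pos_lt_pos _ h.2.1).le le_rfl

theorem mem_of_edge_succ (H : TopLayer G (verts n F) k N M p A μ) {m : ℕ}
    (h : Edge (verts n F) M p μ (m + 1)) : p (μ m) ∈ verts n F :=
  h.2.2 _ le_rfl (H.pos_lt_pos _ h.2.1).le

theorem neighbor_marked (H : TopLayer G (verts n F) k N M p A μ) (hF : InducedCycle G n F) {m : ℕ}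
    (hm : m < M) {y : V} (hy : y ∈ verts n F) (ha : G.Adj (p (μ m)) y) :
    (y = p (μ m - 1) ∧ Edge (verts n F) M p μ m) ∨
    (y = p (μ m + 1) ∧ Edge (verts n F) M p μ (m + 1)) ∨ y ∈ A (p (μ m)) := by
  have hN := H.pos_lt m hm
  rcases H.neighbor _ hN y hy ha with ⟨b, hb, rfl⟩ | h
  · rcases (H.adj _ hN b hb).1 ha with h | h
    · right; left
      subst h
      exact ⟨rfl, H.edge_right hF hm hb hy⟩
    · left
      rw [← h, Nat.add_sub_cancel]
      refine ⟨rfl, H.edge_left hF hm (by omega) ?_⟩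
      rw [← h, Nat.add_sub_cancel]
      exact hy
  · exact Or.inr (Or.inr h)

theorem edge_and_edge (H : TopLayer G (verts n F) k N M p A μ) (hF : InducedCycle G n F) {m : ℕ}
    (hm : m < M) (hS : p (μ m) ∈ verts n F) (hA : ∀ x ∈ A (p (μ m)), x ∉ verts n F) :
    Edge (verts n F) M p μ m ∧ Edge (verts n F) M p μ (m + 1) := by
  obtain ⟨y, hy, z, hz, hyz, ay, az, -⟩ := hF.exists_neighbors hS
  rcases H.neighbor_marked hF hm hy ay with ⟨rfl, h⟩ | ⟨rfl, h⟩ | h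
  · rcases H.neighbor_marked hF hm hz az with ⟨rfl, h'⟩ | ⟨rfl, h'⟩ | h'
    · exact absurd rfl hyz
    · exact ⟨h, h'⟩
    · exact absurd hz (hA z h')
  · rcases H.neighbor_marked hF hm hz az with ⟨rfl, h'⟩ | ⟨rfl, h'⟩ | h'
    · exact ⟨h', h⟩
    · exact absurd rfl hyz
    · exact absurd hz (hA z h')
  · exact absurd hy (hA y h)

theorem edge_or_edge (H : TopLayer G (verts n F) k N M p A μ) (hF : InducedCycle G n F) {m : ℕ}
    (hm : m < M) (hS : p (μ m) ∈ verts n F) {x : V}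
    (hA : ∀ y ∈ A (p (μ m)), y ∈ verts n F → y = x) :
    Edge (verts n F) M p μ m ∨ Edge (verts n F) M p μ (m + 1) := by
  obtain ⟨y, hy, z, hz, hyz, ay, az, -⟩ := hF.exists_neighbors hS
  rcases H.neighbor_marked hF hm hy ay with ⟨rfl, h⟩ | ⟨rfl, h⟩ | h
  · exact Or.inl h
  · exact Or.inr h
  · rcases H.neighbor_marked hF hm hz az with ⟨rfl, h'⟩ | ⟨rfl, h'⟩ | h'
    · exact Or.inl h'
    · exact Or.inr h'
    · exact absurd ((hA y h hy).trans (hA z h' hz).symm) hyz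

theorem exists_ancestor (H : TopLayer G (verts n F) k N M p A μ) (hF : InducedCycle G n F) {m : ℕ}
    (hm : m < M) (hS : p (μ m) ∈ verts n F) (he : ¬ Edge (verts n F) M p μ (m + 1)) :
    ∃ x ∈ A (p (μ m)), x ∈ verts n F := by
  by_contra hc
  push Not at hc
  exact he (H.edge_and_edge hF hm hS hc).2

/-- Two ancestors of one vertex are adjacent, so the three vertices would be a triangle filling the
whole cycle, against `4 ≤ n`. -/
theorem notMem_of_two_ancestors (H : TopLayer G (verts n F) k N M p A μ) (hF : InducedCycle G n F)
    (hn : 4 ≤ n) {m : ℕ} (hm : m < M) {x y : V} (hx : x ∈ A (p (μ m))) (hxS : x ∈ verts n F)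
    (hy : y ∈ A (p (μ m))) (hyS : y ∈ verts n F) (hne : y ≠ x) : p (μ m) ∉ verts n F := by
  classical
  intro hS
  have hN := H.pos_lt m hm
  have ax := H.adj_ancestor _ hN x hx
  have ay := H.adj_ancestor _ hN y hy
  have axy : G.Adj x y := by
    rcases H.types _ hN with h | ⟨v, h⟩ | ⟨v, w, h, hvw⟩
    · simp [h] at hx
    · simp only [h, List.mem_singleton] at hx hy
      exact absurd (hy.trans hx.symm) hne
    · simp only [h, List.mem_cons, List.not_mem_nil, or_false] at hx hy
      rcases hx with rfl | rfl <;> rcases hy with rfl | rfl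
      · exact absurd rfl hne
      · exact hvw
      · exact hvw.symm
      · exact absurd rfl hne
  have hcard := hF.eq_verts_of_two_neighbors (T := {p (μ m), x, y})
    (by intro z hz; simp only [Finset.mem_insert, Finset.mem_singleton] at hz
        rcases hz with rfl | rfl | rfl <;> assumption) ⟨x, by simp⟩ (by
      intro z hz
      simp only [Finset.mem_insert, Finset.mem_singleton] at hz
      rcases hz with rfl | rfl | rfl
      · exact ⟨x, by simp, y, by simp, hne.symm, ax, ay⟩
      · exact ⟨p (μ m), by simp, y, by simp, ay.ne, ax.symm, axy⟩
      · exact ⟨p (μ m), by simp, x, by simp, ax.ne, ay.symm, axy.symm⟩)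
  have := Finset.card_le_three (a := p (μ m)) (b := x) (c := y)
  omega

open scoped Classical in
theorem card_arc (H : TopLayer G (verts n F) k N M p A μ) {a b : ℕ} (hb : b < N) :
    ((Finset.Icc a b).image p).card = b + 1 - a := by
  rw [Finset.card_image_of_injOn, Nat.card_Icc]
  intro i hi j hj h
  simp only [Finset.coe_Icc, Set.mem_Icc] at hi hj
  exact H.inj i (by omega) j (by omega) h

open scoped Classical in
theorem arc_neighbors (H : TopLayer G (verts n F) k N M p A μ) {a b : ℕ}
    (hb : b < N) {x y : V} (ax : G.Adj (p a) x) (ay : G.Adj (p b) y) (hab : a < b)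
    (hx : ∀ c < N, x ≠ p c) (hy : ∀ c < N, y ≠ p c) {T : Finset V}
    (hT : (Finset.Icc a b).image p ⊆ T) (hxT : x ∈ T) (hyT : y ∈ T) :
    ∀ z ∈ (Finset.Icc a b).image p, ∃ v ∈ T, ∃ w ∈ T, v ≠ w ∧ G.Adj z v ∧ G.Adj z w := by
  have mem : ∀ c, a ≤ c → c ≤ b → p c ∈ T := fun c h1 h2 =>
    hT (Finset.mem_image_of_mem _ (Finset.mem_Icc.2 ⟨h1, h2⟩))
  intro z hz
  obtain ⟨c, hc, rfl⟩ := Finset.mem_image.1 hz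
  obtain ⟨h1, h2⟩ := Finset.mem_Icc.1 hc
  rcases Nat.eq_or_lt_of_le h1 with rfl | h1
  · exact ⟨x, hxT, p (a + 1), mem _ (by omega) (by omega), hx _ (by omega), ax,
      (H.adj _ (by omega) _ (by omega)).2 (Or.inl rfl)⟩
  rcases Nat.eq_or_lt_of_le h2 with rfl | h2
  · exact ⟨y, hyT, p (c - 1), mem _ (by omega) (by omega), hy _ (by omega), ay,
      (H.adj _ (by omega) _ (by omega)).2 (Or.inr (by omega))⟩
  · refine ⟨p (c - 1), mem _ (by omega) (by omega), p (c + 1), mem _ (by omega) (by omega),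
      fun h => ?_, (H.adj _ (by omega) _ (by omega)).2 (Or.inr (by omega)),
      (H.adj _ (by omega) _ (by omega)).2 (Or.inl rfl)⟩
    have := H.inj _ (by omega) _ (by omega) h
    omega

/-- A cycle that contains a subpath of the top layer and a common neighbour of its ends. -/
theorem length_of_common (H : TopLayer G (verts n F) k N M p A μ) (hF : InducedCycle G n F)
    {a b : ℕ} (hab : a < b) (hb : b < N) (hS : ∀ c, a ≤ c → c ≤ b → p c ∈ verts n F) {x : V}
    (hxS : x ∈ verts n F) (hxa : x ∈ A (p a)) (hxb : x ∈ A (p b)) : n = b - a + 2 := by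
  classical
  have ax := H.adj_ancestor a (by omega) x hxa
  have bx := H.adj_ancestor b hb x hxb
  have hne := H.ancestor_ne b hb x hxb
  have hx : x ∉ (Finset.Icc a b).image p := by
    simp only [Finset.mem_image, Finset.mem_Icc, not_exists, not_and]
    intro c hc h
    exact hne c (by omega) h.symm
  have hcard := hF.eq_verts_of_two_neighbors (T := insert x ((Finset.Icc a b).image p))
    (by
      intro z hz
      rcases Finset.mem_insert.1 hz with rfl | hz
      · exact hxS
      · obtain ⟨c, hc, rfl⟩ := Finset.mem_image.1 hz
        obtain ⟨h1, h2⟩ := Finset.mem_Icc.1 hc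
        exact hS c h1 h2) ⟨x, by simp⟩ (by
      intro z hz
      rcases Finset.mem_insert.1 hz with rfl | hz
      · refine ⟨p a, ?_, p b, ?_, fun h => ?_, ax.symm, bx.symm⟩
        · exact Finset.mem_insert_of_mem (Finset.mem_image_of_mem _ (by simp; omega))
        · exact Finset.mem_insert_of_mem (Finset.mem_image_of_mem _ (by simp; omega))
        · have := H.inj a (by omega) b hb h
          omega
      · exact H.arc_neighbors hb ax bx hab hne hne (Finset.subset_insert _ _) (by simp) (by simp)
          z hz)
  rw [Finset.card_insert_of_notMem hx, H.card_arc hb] at hcard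
  omega

/-- A cycle that contains a subpath of the top layer and two adjacent neighbours of its ends. -/
theorem length_of_adj (H : TopLayer G (verts n F) k N M p A μ) (hF : InducedCycle G n F)
    {a b : ℕ} (hab : a < b) (hb : b < N) (hS : ∀ c, a ≤ c → c ≤ b → p c ∈ verts n F) {x y : V}
    (hxS : x ∈ verts n F) (hyS : y ∈ verts n F) (hxa : x ∈ A (p a)) (hyb : y ∈ A (p b))
    (hxy : G.Adj x y) : n = b - a + 3 := by
  classical
  have ax := H.adj_ancestor a (by omega) x hxa
  have bx := H.adj_ancestor b hb y hyb
  have hnx := H.ancestor_ne a (by omega) x hxa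
  have hny := H.ancestor_ne b hb y hyb
  have hy : y ∉ (Finset.Icc a b).image p := by
    simp only [Finset.mem_image, Finset.mem_Icc, not_exists, not_and]
    intro c hc h
    exact hny c (by omega) h.symm
  have hx : x ∉ insert y ((Finset.Icc a b).image p) := by
    simp only [Finset.mem_insert, Finset.mem_image, Finset.mem_Icc, not_or, not_exists, not_and]
    refine ⟨hxy.ne, ?_⟩
    intro c hc h
    exact hnx c (by omega) h.symm
  have hcard := hF.eq_verts_of_two_neighbors (T := insert x (insert y ((Finset.Icc a b).image p)))
    (by
      intro z hz
      rcases Finset.mem_insert.1 hz with rfl | hz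
      · exact hxS
      rcases Finset.mem_insert.1 hz with rfl | hz
      · exact hyS
      · obtain ⟨c, hc, rfl⟩ := Finset.mem_image.1 hz
        obtain ⟨h1, h2⟩ := Finset.mem_Icc.1 hc
        exact hS c h1 h2) ⟨x, by simp⟩ (by
      intro z hz
      rcases Finset.mem_insert.1 hz with rfl | hz
      · refine ⟨p a, ?_, y, by simp, (hny a (by omega)).symm, ax.symm, hxy⟩
        exact Finset.mem_insert_of_mem (Finset.mem_insert_of_mem
          (Finset.mem_image_of_mem _ (by simp; omega)))
      rcases Finset.mem_insert.1 hz with rfl | hz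
      · refine ⟨p b, ?_, x, by simp, (hnx b (by omega)).symm, bx.symm, hxy.symm⟩
        exact Finset.mem_insert_of_mem (Finset.mem_insert_of_mem
          (Finset.mem_image_of_mem _ (by simp; omega)))
      · exact H.arc_neighbors hb ax bx hab hnx hny
          ((Finset.subset_insert _ _).trans (Finset.subset_insert _ _)) (by simp) (by simp) z hz)
  rw [Finset.card_insert_of_notMem hx, Finset.card_insert_of_notMem hy, H.card_arc hb] at hcard
  omega

/-- The arc and `x` would be the whole cycle, of length an odd gap plus two. -/
theorem not_edge_of_common (H : TopLayer G (verts n F) k N M p A μ) (hF : InducedCycle G n F)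
    (hn : ¬ Odd n) {m : ℕ} {x : V} (hx : x ∈ A (p (μ m))) (hx' : x ∈ A (p (μ (m + 1))))
    (hxS : x ∈ verts n F) : ¬ Edge (verts n F) M p μ (m + 1) := by
  intro h
  have h1 := H.pos_lt_pos m h.2.1
  have h2 := H.length_of_common hF h1 (H.pos_lt _ h.2.1) h.2.2 hxS hx hx'
  apply hn
  rw [h2]
  exact (H.gap_odd m h.2.1 x hx hx').add_even even_two

/-- The arc with `x` and `y` would be the whole cycle, of length an even gap plus three. -/
theorem not_edge_of_adj (H : TopLayer G (verts n F) k N M p A μ) (hF : InducedCycle G n F)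
    (hn : ¬ Odd n) {m : ℕ} (hd : ∀ x ∈ A (p (μ m)), x ∉ A (p (μ (m + 1)))) {x y : V}
    (hx : x ∈ A (p (μ m))) (hy : y ∈ A (p (μ (m + 1))))
    (hxS : x ∈ verts n F) (hyS : y ∈ verts n F) (hxy : G.Adj x y) :
    ¬ Edge (verts n F) M p μ (m + 1) := by
  intro h
  have h1 := H.pos_lt_pos m h.2.1
  have h2 := H.length_of_adj hF h1 (H.pos_lt _ h.2.1) h.2.2 hxS hyS hx hy hxy
  apply hn
  rw [h2]
  exact (H.gap_even m h.2.1 hd).add_odd (by decide)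

/-- Take the rightmost vertex of the cycle on the path: an unmarked one would have a right neighbour
on the cycle. -/
theorem exists_pos_of_mem (H : TopLayer G (verts n F) k N M p A μ) (hF : InducedCycle G n F)
    {a : ℕ} (ha : a < N) (hS : p a ∈ verts n F) :
    ∃ m < M, p (μ m) ∈ verts n F ∧ ¬ Edge (verts n F) M p μ (m + 1) := by
  classical
  set T := (Finset.range N).filter (fun a => p a ∈ verts n F) with hT
  have hne : T.Nonempty := ⟨a, by simp [hT, ha, hS]⟩
  obtain ⟨b, hb, hmax⟩ := T.exists_max_image id hne
  simp only [hT, Finset.mem_filter, Finset.mem_range, id] at hb hmax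
  have hA : A (p b) ≠ [] := fun h => by
    obtain ⟨-, h1, -, h2⟩ := H.of_unmarked hF hb.1 h hb.2
    have := hmax (b + 1) ⟨h1, h2⟩
    omega
  obtain ⟨m, hm, rfl⟩ := H.exists_pos b hb.1 hA
  refine ⟨m, hm, hb.2, fun he => ?_⟩
  have h1 := H.pos_lt_pos m he.2.1
  have := hmax _ ⟨H.pos_lt _ he.2.1, H.mem_of_edge he⟩
  omega

/-- A cycle of length at least four that meets the top layer is long. -/
theorem le_length (H : TopLayer G (verts n F) k N M p A μ) (hF : InducedCycle G n F)
    (hn : 4 ≤ n) {a : ℕ} (ha : a < N) (hS : p a ∈ verts n F) : k ≤ n := by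
  classical
  obtain ⟨m, hm, hmS, he⟩ := H.exists_pos_of_mem hF ha hS
  -- The rightmost vertex cannot be continued to the right, so its two cycle neighbours are one
  -- ancestor `x` and its left neighbour. The gap on its left has at least `k - 1` vertices, and `x`
  -- is one more.
  obtain ⟨x, hx, hxS⟩ := H.exists_ancestor hF hm hmS he
  have hE : Edge (verts n F) M p μ m := by
    refine (H.edge_or_edge hF hm hmS (x := x) fun y hy hyS => ?_).resolve_right he
    by_contra hne
    exact H.notMem_of_two_ancestors hF hn hm hx hxS hy hyS hne hmS
  obtain ⟨m, rfl⟩ : ∃ m', m = m' + 1 := ⟨m - 1, by have := hE.1; omega⟩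
  have hsub : insert x ((Finset.Icc (μ m) (μ (m + 1))).image p) ⊆ verts n F := by
    intro z hz
    rcases Finset.mem_insert.1 hz with rfl | hz
    · exact hxS
    · obtain ⟨c, hc, rfl⟩ := Finset.mem_image.1 hz
      obtain ⟨h1, h2⟩ := Finset.mem_Icc.1 hc
      exact hE.2.2 c h1 h2
  have hcard := Finset.card_le_card hsub
  have hxi : x ∉ (Finset.Icc (μ m) (μ (m + 1))).image p := by
    simp only [Finset.mem_image, Finset.mem_Icc, not_exists, not_and]
    intro c hc h
    exact H.ancestor_ne _ (H.pos_lt _ hm) x hx c (by have := H.pos_lt _ hm; omega) h.symm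
  rw [Finset.card_insert_of_notMem hxi, H.card_arc (H.pos_lt _ hm), hF.card_verts] at hcard
  have := H.gap m hm
  have := H.pos_lt_pos m hm
  omega

end TopLayer

/-! ### From marked vertices to zones. -/

/-- The marked vertices of a top layer are distributed over the zones `Z 0, …, Z (J - 1)`; the
marked vertices of `Z j` have the indices `σ j, …, σ (j + 1) - 1`. -/
structure Zoning (J M : ℕ) (p : ℕ → V) (A : V → List V) (μ : ℕ → ℕ) (Z : ℕ → Zone V)
    (σ : ℕ → ℕ) : Prop where
  zero : σ 0 = 0
  succ : ∀ j < J, σ (j + 1) = σ j + (Z j).size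
  final : σ J = M
  centers : ∀ j < J, ∀ i < (Z j).size, A (p (μ (σ j + i))) = (Z j).centers
  size : ∀ j < J, (Z j).size = 3 ∨ (Z j).size = 4

/-- The number of marked vertices of the zone `Z j` that lie in `S`. -/
noncomputable def zoneCount (S : Finset V) (p : ℕ → V) (μ : ℕ → ℕ) (Z : ℕ → Zone V) (σ : ℕ → ℕ)
    (j : ℕ) : ℕ :=
  ∑ i ∈ Finset.range (Z j).size, ind (p (μ (σ j + i)) ∈ S)

namespace Zoning

variable {n k N M J : ℕ} {F : ℕ → V} {p : ℕ → V} {A : V → List V} {μ : ℕ → ℕ} {Z : ℕ → Zone V}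
  {σ : ℕ → ℕ}

theorem le_final (hZ : Zoning J M p A μ Z σ) {j : ℕ} (hj : j ≤ J) : σ j ≤ M := by
  have : ∀ d, j + d ≤ J → σ j ≤ σ (j + d) := by
    intro d
    induction d with
    | zero => intro _; exact le_rfl
    | succ d ih =>
      intro hd
      rw [← add_assoc, hZ.succ (j + d) (by omega)]
      exact (ih (by omega)).trans (Nat.le_add_right _ _)
  rw [← hZ.final]
  simpa [hj] using this (J - j) (by omega)

theorem index_lt (hZ : Zoning J M p A μ Z σ) {j i : ℕ} (hj : j < J) (hi : i < (Z j).size) :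
    σ j + i < M := by
  have := hZ.le_final (show j + 1 ≤ J by omega)
  rw [hZ.succ j hj] at this
  omega

theorem exists_zone (hZ : Zoning J M p A μ Z σ) {m : ℕ} (hm : m < M) :
    ∃ j < J, ∃ i < (Z j).size, m = σ j + i := by
  rw [← hZ.final] at hm
  have : ∀ j ≤ J, m < σ j → ∃ j < J, ∃ i < (Z j).size, m = σ j + i := by
    intro j
    induction j with
    | zero => intro _ h; rw [hZ.zero] at h; omega
    | succ j ih =>
      intro hj h
      by_cases h1 : m < σ j
      · exact ih (by omega) h1
      · rw [hZ.succ j hj] at h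
        exact ⟨j, hj, m - σ j, by omega, by omega⟩
  exact this J le_rfl hm

theorem last_centers (hZ : Zoning J M p A μ Z σ) {j : ℕ} (hj : j < J) :
    ∃ m, σ (j + 1) = m + 1 ∧ σ j ≤ m ∧ A (p (μ m)) = (Z j).centers := by
  have h := hZ.succ j hj
  have hs := hZ.size j hj
  refine ⟨σ j + ((Z j).size - 1), by omega, by omega, hZ.centers j hj _ (by omega)⟩

theorem first_centers (hZ : Zoning J M p A μ Z σ) {j : ℕ} (hj : j < J) :
    A (p (μ (σ j))) = (Z j).centers := by
  have hs := hZ.size j hj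
  exact hZ.centers j hj 0 (by omega)

/-- With no ancestor available, a marked vertex on the cycle must use both of its path neighbours,
so the cycle runs straight through it. -/
theorem pass (hZ : Zoning J M p A μ Z σ) (H : TopLayer G (verts n F) k N M p A μ)
    (hF : InducedCycle G n F) {j : ℕ} (hj : j < J) (hC : ∀ x ∈ (Z j).centers, x ∉ verts n F) :
    ∀ i < (Z j).size, (p (μ (σ j + i)) ∈ verts n F ↔ Edge (verts n F) M p μ (σ j + i)) ∧
      (Edge (verts n F) M p μ (σ j + i) ↔ Edge (verts n F) M p μ (σ j + i + 1)) := by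
  intro i hi
  have hlt := hZ.index_lt hj hi
  have key := H.edge_and_edge hF hlt
  rw [hZ.centers j hj i hi] at key
  exact ⟨⟨fun h => (key h hC).1, H.mem_of_edge⟩,
    ⟨fun h => (key (H.mem_of_edge h) hC).2, fun h => (key (H.mem_of_edge_succ h) hC).1⟩⟩

theorem pass_gate (hZ : Zoning J M p A μ Z σ) (H : TopLayer G (verts n F) k N M p A μ)
    (hF : InducedCycle G n F) {j : ℕ} (hj : j < J) (hC : ∀ x ∈ (Z j).centers, x ∉ verts n F) :
    ∀ i ≤ (Z j).size, (Edge (verts n F) M p μ (σ j) ↔ Edge (verts n F) M p μ (σ j + i)) := by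
  intro i
  induction i with
  | zero => simp
  | succ i ih =>
    intro hi
    exact (ih (by omega)).trans (hZ.pass H hF hj hC i (by omega)).2

theorem pass_count (hZ : Zoning J M p A μ Z σ) (H : TopLayer G (verts n F) k N M p A μ)
    (hF : InducedCycle G n F) {j : ℕ} (hj : j < J) (hC : ∀ x ∈ (Z j).centers, x ∉ verts n F) :
    zoneCount (verts n F) p μ Z σ j = ind (Edge (verts n F) M p μ (σ j)) * (Z j).size := by
  rw [zoneCount, Finset.sum_congr rfl (g := fun _ => ind (Edge (verts n F) M p μ (σ j)))]
  · rw [Finset.sum_const, Finset.card_range, smul_eq_mul, mul_comm]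
  · intro i hi
    rw [Finset.mem_range] at hi
    exact ind_congr ((hZ.pass H hF hj hC i hi).1.trans (hZ.pass_gate H hF hj hC i hi.le).symm)

theorem not_inner_edge (hZ : Zoning J M p A μ Z σ) (H : TopLayer G (verts n F) k N M p A μ)
    (hF : InducedCycle G n F) (hn : ¬ Odd n) {j : ℕ} (hj : j < J) {x : V}
    (hx : x ∈ (Z j).centers) (hxS : x ∈ verts n F) {i : ℕ} (hi : i + 1 < (Z j).size) :
    ¬ Edge (verts n F) M p μ (σ j + i + 1) := by
  refine H.not_edge_of_common hF hn (x := x) ?_ ?_ hxS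
  · rw [hZ.centers j hj i (by omega)]; exact hx
  · rw [add_assoc, hZ.centers j hj _ hi]; exact hx

/-- No gap inside the zone is on the cycle, because of the common centre `x`, while each marked
vertex on the cycle needs an adjacent gap on it. So only the two extreme marked vertices can occur,
each exactly when its outer gate is open. -/
theorem single (hZ : Zoning J M p A μ Z σ) (H : TopLayer G (verts n F) k N M p A μ)
    (hF : InducedCycle G n F) (hn : ¬ Odd n) {j : ℕ} (hj : j < J) {x : V}
    (hx : x ∈ (Z j).centers) (hxS : x ∈ verts n F)
    (hC : ∀ y ∈ (Z j).centers, y ∈ verts n F → y = x) :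
    zoneCount (verts n F) p μ Z σ j =
      ind (Edge (verts n F) M p μ (σ j)) + ind (Edge (verts n F) M p μ (σ (j + 1))) := by
  have hin : ∀ i, i + 1 < (Z j).size → _ := fun i => hZ.not_inner_edge H hF hn hj hx hxS
  have mem : ∀ i < (Z j).size, p (μ (σ j + i)) ∈ verts n F →
      Edge (verts n F) M p μ (σ j + i) ∨ Edge (verts n F) M p μ (σ j + i + 1) := by
    intro i hi h
    refine H.edge_or_edge hF (hZ.index_lt hj hi) h (x := x) ?_
    rw [hZ.centers j hj i hi]; exact hC
  have hs := hZ.size j hj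
  have inner : ∀ i, i + 2 < (Z j).size → ind (p (μ (σ j + (i + 1))) ∈ verts n F) = 0 := by
    intro i hi
    apply ind_false
    intro h
    rcases mem (i + 1) (by omega) h with h' | h'
    · exact hin i (by omega) h'
    · exact hin (i + 1) (by omega) h'
  have e0 : p (μ (σ j)) ∈ verts n F ↔ Edge (verts n F) M p μ (σ j) :=
    ⟨fun h => (mem 0 (by omega) h).resolve_right (hin 0 (by omega)), H.mem_of_edge⟩
  obtain ⟨s, hs'⟩ : ∃ s, (Z j).size = s + 3 := ⟨(Z j).size - 3, by omega⟩
  have e1 : p (μ (σ j + (s + 2))) ∈ verts n F ↔ Edge (verts n F) M p μ (σ (j + 1)) := by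
    rw [hZ.succ j hj, hs']
    exact ⟨fun h => (mem (s + 2) (by omega) h).resolve_left (hin (s + 1) (by omega)),
      H.mem_of_edge_succ⟩
  rw [← ind_congr e0, ← ind_congr e1, zoneCount, hs', Finset.sum_range_succ, Finset.sum_range_succ',
    Finset.sum_eq_zero, zero_add]
  · rfl
  · intro i hi
    rw [Finset.mem_range] at hi
    exact inner i (by omega)

theorem double (hZ : Zoning J M p A μ Z σ) (H : TopLayer G (verts n F) k N M p A μ)
    (hF : InducedCycle G n F) (hn : 4 ≤ n) {j : ℕ} (hj : j < J) {x y : V}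
    (hx : x ∈ (Z j).centers) (hxS : x ∈ verts n F) (hy : y ∈ (Z j).centers)
    (hyS : y ∈ verts n F) (hne : y ≠ x) :
    ¬ Edge (verts n F) M p μ (σ j) ∧ ¬ Edge (verts n F) M p μ (σ (j + 1)) ∧
      zoneCount (verts n F) p μ Z σ j = 0 := by
  have mem : ∀ i < (Z j).size, p (μ (σ j + i)) ∉ verts n F := by
    intro i hi
    have e := hZ.centers j hj i hi
    exact H.notMem_of_two_ancestors hF hn (hZ.index_lt hj hi) (by rwa [e]) hxS (by rwa [e]) hyS hne
  have hs := hZ.size j hj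
  refine ⟨fun h => mem 0 (by omega) (H.mem_of_edge h), fun h => ?_, ?_⟩
  · rw [hZ.succ j hj] at h
    refine mem ((Z j).size - 1) (by omega) (H.mem_of_edge_succ ?_)
    rwa [show σ j + ((Z j).size - 1) + 1 = σ j + (Z j).size by omega]
  · exact Finset.sum_eq_zero fun i hi => ind_false (mem i (Finset.mem_range.1 hi))

/-- An open gate would force the cycle through all four marked vertices of the middle zone and back
to `x`. The gaps are even, odd, odd, odd, even, so with the two edges at `x` the length is odd. -/
theorem skip (hZ : Zoning J M p A μ Z σ) (H : TopLayer G (verts n F) k N M p A μ)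
    (hF : InducedCycle G n F) (hn : ¬ Odd n) {j : ℕ} (hj : j + 2 < J)
    (d1 : ∀ x ∈ (Z j).centers, x ∉ (Z (j + 1)).centers)
    (d2 : ∀ x ∈ (Z (j + 1)).centers, x ∉ (Z (j + 2)).centers)
    (hC : ∀ x ∈ (Z (j + 1)).centers, x ∉ verts n F) (hs : (Z (j + 1)).size = 4) {x : V}
    (hx : x ∈ (Z j).centers) (hx2 : x ∈ (Z (j + 2)).centers) (hxS : x ∈ verts n F) :
    ¬ Edge (verts n F) M p μ (σ (j + 1)) := by
  intro h
  obtain ⟨m, hm, -, hA⟩ := hZ.last_centers (show j < J by omega)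
  have hc := hZ.centers (j + 1) (by omega)
  have hg := hZ.pass_gate H hF (show j + 1 < J by omega) hC
  have h2 := hZ.first_centers hj
  rw [hZ.succ (j + 1) (by omega), hs] at h2
  rw [hs] at hg hc
  rw [hm] at hg hc h h2
  have E1 := h
  have E2 := (hg 1 (by omega)).1 h
  have E3 := (hg 2 (by omega)).1 h
  have E4 := (hg 3 (by omega)).1 h
  have E5 := (hg 4 (by omega)).1 h
  have A1 := hc 0 (by omega)
  have A2 := hc 1 (by omega)
  have A3 := hc 2 (by omega)
  have A4 := hc 3 (by omega)
  simp only [Nat.add_assoc, Nat.reduceAdd] at E2 E3 E4 E5 A1 A2 A3 A4 h2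
  have L := E5.2.1
  have l1 := H.pos_lt_pos m (by omega)
  have l2 := H.pos_lt_pos (m + 1) (by omega)
  have l3 := H.pos_lt_pos (m + 2) (by omega)
  have l4 := H.pos_lt_pos (m + 3) (by omega)
  have l5 := H.pos_lt_pos (m + 4) (by omega)
  simp only [Nat.add_assoc, Nat.reduceAdd] at l1 l2 l3 l4 l5
  have hne : (Z (j + 1)).centers ≠ [] := by
    rw [← A1]; exact H.marked _ (by omega)
  obtain ⟨y, hy⟩ := List.exists_mem_of_ne_nil _ hne
  have p1 := H.gap_even m (by omega) (by rw [hA, A1]; exact d1)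
  have p2 := H.gap_odd (m + 1) (by omega) y (by rw [A1]; exact hy) (by rw [A2]; exact hy)
  have p3 := H.gap_odd (m + 2) (by omega) y (by rw [A2]; exact hy) (by rw [A3]; exact hy)
  have p4 := H.gap_odd (m + 3) (by omega) y (by rw [A3]; exact hy) (by rw [A4]; exact hy)
  have p5 := H.gap_even (m + 4) (by omega) (by rw [A4, h2]; exact d2)
  have hlen := H.length_of_common hF (a := μ m) (b := μ (m + 5)) (by omega) (H.pos_lt _ L)
    (fun c c1 c2 => by
      by_cases b1 : c ≤ μ (m + 1)
      · exact E1.2.2 c c1 b1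
      by_cases b2 : c ≤ μ (m + 2)
      · exact E2.2.2 c (show μ (m + 1) ≤ c by omega) b2
      by_cases b3 : c ≤ μ (m + 3)
      · exact E3.2.2 c (show μ (m + 2) ≤ c by omega) b3
      by_cases b4 : c ≤ μ (m + 4)
      · exact E4.2.2 c (show μ (m + 3) ≤ c by omega) b4
      · exact E5.2.2 c (show μ (m + 4) ≤ c by omega) c2) hxS
    (by rw [hA]; exact hx) (by rw [h2]; exact hx2)
  apply hn
  simp only [Nat.odd_iff, Nat.even_iff, Nat.add_assoc, Nat.reduceAdd] at *
  omega

/-- The zones of a top layer yield a trace of any even hole. -/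
theorem trace (hZ : Zoning J M p A μ Z σ) (H : TopLayer G (verts n F) k N M p A μ)
    (hF : InducedCycle G n F) (hn : ¬ Odd n) (h4 : 4 ≤ n) {N' : ℕ} {u : ℕ → V} {an : ℕ → List V}
    {τ : ℕ → ℕ} (hB : Boxes G N' J u an Z τ) :
    Trace G (verts n F) N' J u an Z τ (fun j => Edge (verts n F) M p μ (σ j))
      (zoneCount (verts n F) p μ Z σ) where
  toBoxes := hB
  gate_zero := by
    rw [hZ.zero]
    exact fun h => absurd h.1 (by omega)
  gate_last := by
    rw [hZ.final]
    exact fun h => absurd h.2.1 (by omega)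
  pass j hj hC := by
    refine ⟨?_, hZ.pass_count H hF hj hC⟩
    rw [hZ.succ j hj]
    exact hZ.pass_gate H hF hj hC _ le_rfl
  single j hj x hx hxS hC := hZ.single H hF hn hj hx hxS hC
  double j hj x hx hxS y hy hyS hne := hZ.double H hF h4 hj hx hxS hy hyS hne
  cross j hj x hx hx' hxS := by
    obtain ⟨m, hm, -, hA⟩ := hZ.last_centers (show j < J by omega)
    have h := hZ.first_centers hj
    rw [hm] at h ⊢
    exact H.not_edge_of_common hF hn (by rwa [hA]) (by rwa [h]) hxS
  cross_adj j hj hd x hx hxS y hy hyS hxy := by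
    obtain ⟨m, hm, -, hA⟩ := hZ.last_centers (show j < J by omega)
    have h := hZ.first_centers hj
    rw [hm] at h ⊢
    exact H.not_edge_of_adj hF hn (by rwa [hA, h]) (by rwa [hA]) (by rwa [h]) hxS hyS hxy
  skip j hj d1 d2 hC hs x hx hx2 hxS := hZ.skip H hF hn hj d1 d2 hC hs hx hx2 hxS

theorem sum_zones (hZ : Zoning J M p A μ Z σ) (f : ℕ → ℕ) :
    ∑ m ∈ Finset.range M, f m =
      ∑ j ∈ Finset.range J, ∑ i ∈ Finset.range (Z j).size, f (σ j + i) := by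
  have : ∀ j ≤ J, ∑ m ∈ Finset.range (σ j), f m =
      ∑ j ∈ Finset.range j, ∑ i ∈ Finset.range (Z j).size, f (σ j + i) := by
    intro j
    induction j with
    | zero => simp [hZ.zero]
    | succ j ih =>
      intro hj
      rw [hZ.succ j hj, Finset.sum_range_add, ih (by omega), Finset.sum_range_succ]
  rw [← hZ.final]
  exact this J le_rfl

open scoped Classical in
-- A top vertex adjacent to `x` is marked with `x` among its ancestors, and each marked vertex lies
-- in exactly one zone.
theorem topDegree_eq_card (hZ : Zoning J M p A μ Z σ) (H : TopLayer G (verts n F) k N M p A μ)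
    {x : V} (hx : ∀ a < N, (G.Adj (p a) x ↔ x ∈ A (p a))) :
    Trace.topDegree J Z (zoneCount (verts n F) p μ Z σ) x =
      ((verts n F).filter (fun y => G.Adj x y ∧ ∃ a < N, y = p a)).card := by
  have e : (verts n F).filter (fun y => G.Adj x y ∧ ∃ a < N, y = p a) =
      ((Finset.range M).filter (fun m => x ∈ A (p (μ m)) ∧ p (μ m) ∈ verts n F)).image
        (fun m => p (μ m)) := by
    ext y
    simp only [Finset.mem_filter, Finset.mem_image, Finset.mem_range]
    constructor
    · rintro ⟨hy, hxy, a, ha, rfl⟩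
      have hA := (hx a ha).1 hxy.symm
      obtain ⟨m, hm, rfl⟩ := H.exists_pos a ha (List.ne_nil_of_mem hA)
      exact ⟨m, ⟨hm, hA, hy⟩, rfl⟩
    · rintro ⟨m, ⟨hm, hA, hy⟩, rfl⟩
      exact ⟨hy, ((hx _ (H.pos_lt m hm)).2 hA).symm, _, H.pos_lt m hm, rfl⟩
  have mono : ∀ d m, m + d + 1 < M → μ m < μ (m + d + 1) := by
    intro d
    induction d with
    | zero => intro m hm; exact H.pos_lt_pos m hm
    | succ d ih =>
      intro m hm
      exact (ih m (by omega)).trans (H.pos_lt_pos (m + d + 1) hm)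
  have inj : Set.InjOn (fun m => p (μ m)) (Finset.range M : Finset ℕ) := by
    intro a ha b hb h
    simp only [Finset.coe_range, Set.mem_Iio] at ha hb
    have h' := H.inj _ (H.pos_lt a ha) _ (H.pos_lt b hb) h
    rcases lt_trichotomy a b with h1 | h1 | h1
    · obtain ⟨d, rfl⟩ := Nat.exists_eq_add_of_lt h1
      exact absurd h' (mono d a hb).ne
    · exact h1
    · obtain ⟨d, rfl⟩ := Nat.exists_eq_add_of_lt h1
      exact absurd h'.symm (mono d b ha).ne
  rw [e, Finset.card_image_of_injOn (inj.mono (Finset.coe_subset.2 (Finset.filter_subset _ _))),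
    Finset.card_filter, hZ.sum_zones]
  refine Finset.sum_congr rfl fun j hj => ?_
  rw [Finset.mem_range] at hj
  split_ifs with h
  · refine Finset.sum_congr rfl fun i hi => ?_
    rw [Finset.mem_range] at hi
    simp only [hZ.centers j hj i hi, h, true_and, ind]
    split_ifs <;> rfl
  · refine (Finset.sum_eq_zero fun i hi => ?_).symm
    rw [Finset.mem_range] at hi
    simp only [hZ.centers j hj i hi, h, false_and, if_false]

end Zoning

/-! ### Indexing marked vertices, zones and boxes in lists. -/

theorem exists_filter_positions {α : Type*} (f : α → Bool) (q : List α) :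
    ∃ μ : ℕ → ℕ, (∀ m < (q.filter f).length, q[μ m]? = (q.filter f)[m]?) ∧
      (∀ m m', m < m' → m' < (q.filter f).length → μ m < μ m') ∧
      ∀ a x, q[a]? = some x → f x = true → ∃ m < (q.filter f).length, μ m = a := by
  induction q with
  | nil => exact ⟨id, by simp⟩
  | cons x q ih =>
    obtain ⟨μ, h1, h2, h3⟩ := ih
    by_cases hx : f x = true
    · refine ⟨fun m => if m = 0 then 0 else μ (m - 1) + 1, ?_, ?_, ?_⟩
      · intro m hm
        rcases m with _ | m
        · simp [hx]
        · simp only [List.filter_cons_of_pos hx, List.length_cons] at hm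
          simpa [hx] using h1 m (by omega)
      · intro m m' hmm' hm'
        simp only [List.filter_cons_of_pos hx, List.length_cons] at hm'
        rcases m with _ | m <;> rcases m' with _ | m'
        · omega
        · simp
        · omega
        · simpa using h2 m m' (by omega) (by omega)
      · intro a y ha hy
        simp only [List.filter_cons_of_pos hx, List.length_cons]
        rcases a with _ | a
        · exact ⟨0, by omega, by simp⟩
        · obtain ⟨m, hm, e⟩ := h3 a y (by simpa using ha) hy
          exact ⟨m + 1, by omega, by simp [e]⟩
    · refine ⟨fun m => μ m + 1, ?_, ?_, ?_⟩
      · intro m hm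
        simp only [List.filter_cons_of_neg hx] at hm ⊢
        simpa using h1 m hm
      · intro m m' hmm' hm'
        simp only [List.filter_cons_of_neg hx] at hm'
        simpa using h2 m m' hmm' hm'
      · intro a y ha hy
        simp only [List.filter_cons_of_neg hx]
        rcases a with _ | a
        · simp only [List.getElem?_cons_zero, Option.some.injEq] at ha
          rw [ha] at hx
          exact absurd hy hx
        · obtain ⟨m, hm, e⟩ := h3 a y (by simpa using ha) hy
          exact ⟨m, hm, by simp [e]⟩

/-- The index of the first marked vertex of the zone of index `j`. -/
def zoneStart (zs : List (Zone V)) (j : ℕ) : ℕ := ((zs.take j).map Zone.size).sum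

theorem zoneStart_succ {zs : List (Zone V)} {j : ℕ} {z : Zone V} (h : zs[j]? = some z) :
    zoneStart zs (j + 1) = zoneStart zs j + z.size := by
  simp [zoneStart, List.take_add_one, h]

theorem zoneStart_length (zs : List (Zone V)) :
    zoneStart zs zs.length = (zs.flatMap fun Z => List.replicate Z.size Z.centers).length := by
  simp [zoneStart, List.length_flatMap]

theorem getElem?_zoneStart {zs : List (Zone V)} {j : ℕ} {z : Zone V} (h : zs[j]? = some z) {i : ℕ}
    (hi : i < z.size) :
    (zs.flatMap fun Z => List.replicate Z.size Z.centers)[zoneStart zs j + i]? =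
      some z.centers := by
  induction zs generalizing j with
  | nil => simp at h
  | cons y zs ih =>
    rcases j with _ | j
    · simp only [List.getElem?_cons_zero, Option.some.injEq] at h
      subst h
      simp [zoneStart, List.getElem?_append, hi]
    · have := ih (by simpa using h)
      rw [← this]
      simp only [zoneStart, List.take_succ_cons, List.map_cons, List.sum_cons, List.flatMap_cons]
      rw [List.getElem?_append_right (by simp; omega)]
      simp only [List.length_replicate]
      congr 1
      omega

/-- The index, among the zones of the layer above `p`, of the first private zone of the vertex of
index `t` of `p`. -/
def boxStart (anc : V → List V) : List V → ℕ → ℕ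
  | _, 0 => 0
  | [], _ + 1 => 0
  | u :: p, t + 1 => (privateZones u (anc u)).length + 1 + boxStart anc p t

theorem zones_cons (anc : V → List V) (u : V) (p : List V) :
    zones anc (u :: p) = privateZones u (anc u) ++
      (match p with | [] => [] | y :: p' => zoneEE u y :: zones anc (y :: p')) := by
  cases p <;> simp [zones]

theorem zones_private (anc : V → List V) {p : List V} {t : ℕ} {x : V} (hx : p[t]? = some x) {i : ℕ}
    {z : Zone V} (hz : (privateZones x (anc x))[i]? = some z) :
    (zones anc p)[boxStart anc p t + i]? = some z := by
  induction p generalizing t with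
  | nil => simp at hx
  | cons u p ih =>
    have hi : i < (privateZones x (anc x)).length := (List.getElem?_eq_some_iff.1 hz).1
    rw [zones_cons]
    rcases t with _ | t
    · simp only [List.getElem?_cons_zero, Option.some.injEq] at hx
      subst hx
      simp only [boxStart, zero_add]
      rw [List.getElem?_append_left hi, hz]
    · simp only [List.getElem?_cons_succ] at hx
      cases p with
      | nil => simp at hx
      | cons y p =>
        rw [List.getElem?_append_right (by simp only [boxStart]; omega), ← ih hx]
        simp only [boxStart]
        rw [show (privateZones u (anc u)).length + 1 + boxStart anc (y :: p) t + i -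
          (privateZones u (anc u)).length = boxStart anc (y :: p) t + i + 1 by omega,
          List.getElem?_cons_succ]

theorem boxStart_succ (anc : V → List V) {p : List V} {t : ℕ} {x y : V} (hx : p[t]? = some x)
    (hy : p[t + 1]? = some y) :
    boxStart anc p (t + 1) = boxStart anc p t + (privateZones x (anc x)).length + 1 := by
  induction p generalizing t with
  | nil => simp at hx
  | cons u p ih =>
    rcases t with _ | t
    · simp only [List.getElem?_cons_zero, Option.some.injEq] at hx
      subst hx
      simp [boxStart]
    · simp only [List.getElem?_cons_succ] at hx hy
      simp only [boxStart]
      rw [ih hx hy]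
      omega

theorem zones_shared (anc : V → List V) {p : List V} {t : ℕ} {x y : V} (hx : p[t]? = some x)
    (hy : p[t + 1]? = some y) :
    (zones anc p)[boxStart anc p t + (privateZones x (anc x)).length]? = some (zoneEE x y) := by
  induction p generalizing t with
  | nil => simp at hx
  | cons u p ih =>
    rw [zones_cons]
    cases p with
    | nil => simp at hy
    | cons w p =>
      rcases t with _ | t
      · simp only [List.getElem?_cons_zero, Option.some.injEq, List.getElem?_cons_succ] at hx hy
        subst hx
        subst hy
        simp [boxStart]
      · simp only [List.getElem?_cons_succ] at hx hy
        rw [List.getElem?_append_right (by simp only [boxStart]; omega), ← ih hx hy]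
        simp only [boxStart]
        rw [show (privateZones u (anc u)).length + 1 + boxStart anc (w :: p) t +
          (privateZones x (anc x)).length - (privateZones u (anc u)).length =
          boxStart anc (w :: p) t + (privateZones x (anc x)).length + 1 by omega,
          List.getElem?_cons_succ]

theorem length_zones (anc : V → List V) {p : List V} {t : ℕ} {x : V} (hx : p[t]? = some x)
    (ht : t + 1 = p.length) :
    (zones anc p).length = boxStart anc p t + (privateZones x (anc x)).length := by
  induction p generalizing t with
  | nil => simp at hx
  | cons u p ih =>
    rw [zones_cons]
    cases p with
    | nil =>
      have : t = 0 := by simpa using ht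
      subst this
      simp only [List.getElem?_cons_zero, Option.some.injEq] at hx
      subst hx
      simp [boxStart]
    | cons w p =>
      rcases t with _ | t
      · simp at ht
      · simp only [List.getElem?_cons_succ] at hx
        have := ih hx (by simpa using ht)
        simp only [List.length_append, List.length_cons, this, boxStart]
        omega

/-- The converse of `zones_private` and `zones_shared`: it locates an arbitrary zone, which is what
bounds its possible centres. -/
theorem exists_box (anc : V → List V) {p : List V} {j : ℕ} {z : Zone V}
    (hz : (zones anc p)[j]? = some z) :
    ∃ t x, p[t]? = some x ∧
      ((∃ i, j = boxStart anc p t + i ∧ (privateZones x (anc x))[i]? = some z) ∨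
        (j = boxStart anc p t + (privateZones x (anc x)).length ∧
          ∃ y, p[t + 1]? = some y ∧ z = zoneEE x y)) := by
  induction p generalizing j with
  | nil => simp [zones] at hz
  | cons u p ih =>
    rw [zones_cons] at hz
    by_cases hj : j < (privateZones u (anc u)).length
    · rw [List.getElem?_append_left hj] at hz
      exact ⟨0, u, rfl, Or.inl ⟨j, by simp [boxStart], hz⟩⟩
    · rw [List.getElem?_append_right (by omega)] at hz
      cases p with
      | nil => simp at hz
      | cons w p =>
        rcases h : j - (privateZones u (anc u)).length with _ | j'
        · rw [h] at hz
          simp only [List.getElem?_cons_zero, Option.some.injEq] at hz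
          exact ⟨0, u, rfl, Or.inr ⟨by simp only [boxStart]; omega, w, rfl, hz.symm⟩⟩
        · rw [h, List.getElem?_cons_succ] at hz
          obtain ⟨t, x, hx, h'⟩ := ih hz
          refine ⟨t + 1, x, by simpa using hx, ?_⟩
          rcases h' with ⟨i, rfl, hi⟩ | ⟨e, y, hy, hzy⟩
          · exact Or.inl ⟨i, by simp only [boxStart]; omega, hi⟩
          · exact Or.inr ⟨by simp only [boxStart]; omega, y, by simpa using hy, hzy⟩

theorem of_mem_privateZones {u : V} {L : List V}
    (hL : L = [] ∨ (∃ v, L = [v]) ∨ ∃ v w, L = [v, w] ∧ G.Adj v w) (hu : ∀ v ∈ L, G.Adj u v)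
    {z : Zone V} (hz : z ∈ privateZones u L) :
    (z.size = 3 ∨ z.size = 4) ∧
      ((∃ x, z.centers = [x]) ∨ ∃ x y, z.centers = [x, y] ∧ G.Adj x y) ∧
      ∀ x ∈ z.centers, x = u ∨ x ∈ L := by
  rcases hL with rfl | ⟨v, rfl⟩ | ⟨v, w, rfl, hvw⟩
  · simp only [privateZones, List.mem_singleton] at hz
    subst hz
    simp [zoneO]
  · simp only [privateZones, List.mem_cons, List.not_mem_nil, or_false] at hz
    have := hu v (by simp)
    rcases hz with rfl | rfl | rfl <;> simp [zoneO, zoneOO, this]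
  · simp only [privateZones, List.mem_cons, List.not_mem_nil, or_false] at hz
    have h1 := hu v (by simp)
    have h2 := hu w (by simp)
    rcases hz with rfl | rfl | rfl | rfl | rfl | rfl | rfl | rfl | rfl <;>
      simp [zoneE, zoneEE, zoneO, zoneOO, h1, h2, hvw]

theorem mem_ancestors {P : ℕ → List V} {i : ℕ} {u v : V} :
    v ∈ ancestors G P i u ↔ (∃ j < i, v ∈ P j) ∧ G.Adj u v := by
  simp [ancestors, List.mem_filter, List.mem_flatMap]

theorem IsPathIn.adj_iff {p : List V} (h : IsPathIn G p) {a b : ℕ} {x y : V} (hx : p[a]? = some x)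
    (hy : p[b]? = some y) : G.Adj x y ↔ a + 1 = b ∨ b + 1 = a := by
  obtain ⟨ha, rfl⟩ := List.getElem?_eq_some_iff.1 hx
  obtain ⟨hb, rfl⟩ := List.getElem?_eq_some_iff.1 hy
  exact h.2 a b ha hb

theorem IsPathIn.eq_of_eq {p : List V} (h : IsPathIn G p) {a b : ℕ} {x : V} (hx : p[a]? = some x)
    (hy : p[b]? = some x) : a = b := by
  obtain ⟨ha, e⟩ := List.getElem?_eq_some_iff.1 hx
  obtain ⟨hb, e'⟩ := List.getElem?_eq_some_iff.1 hy
  exact h.1.getElem_inj_iff.1 (e.trans e'.symm)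

/-! ### The layers of a wheel provide boxes, zonings and top layers. -/

namespace IsLayering

variable {l k : ℕ} {P : ℕ → List V}

theorem eq_of_mem (hP : IsLayering G l k P) {x : V} {i j : ℕ} (hi : i ≤ l) (hj : j ≤ l)
    (hxi : x ∈ P i) (hxj : x ∈ P j) : i = j := by
  obtain ⟨m, -, h⟩ := hP.partition x
  exact (h i ⟨hi, hxi⟩).trans (h j ⟨hj, hxj⟩).symm

theorem exists_zone_of_marked (hP : IsLayering G l k P) {i : ℕ} (hi : i < l) {x : V}
    (hx : x ∈ P (i + 1)) (hA : ancestors G P (i + 1) x ≠ []) :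
    ∃ z ∈ zones (ancestors G P i) (P i), ancestors G P (i + 1) x = z.centers := by
  have h : ancestors G P (i + 1) x ∈
      ((P (i + 1)).map (ancestors G P (i + 1))).filter (fun A => !A.isEmpty) := by
    simp only [List.mem_filter, List.mem_map]
    exact ⟨⟨x, hx, rfl⟩, by simpa using hA⟩
  rw [hP.marked i hi, List.mem_flatMap] at h
  obtain ⟨z, hz, h⟩ := h
  exact ⟨z, hz, List.eq_of_mem_replicate h⟩

/-- The ancestors of a marked vertex are the centres of a zone: one vertex, two consecutive vertices
of the layer below, a vertex of that layer with one of its ancestors, or both ancestors of such a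
vertex. The last pair is adjacent by induction on the layer. -/
theorem types (hP : IsLayering G l k P) {i : ℕ} (hi : i ≤ l) {x : V} (hx : x ∈ P i) :
    ancestors G P i x = [] ∨ (∃ v, ancestors G P i x = [v]) ∨
      ∃ v w, ancestors G P i x = [v, w] ∧ G.Adj v w := by
  induction i generalizing x with
  | zero => left; simp [ancestors]
  | succ i ih =>
    by_cases hA : ancestors G P (i + 1) x = []
    · exact Or.inl hA
    right
    obtain ⟨z, hz, e⟩ := hP.exists_zone_of_marked hi hx hA
    rw [e]
    obtain ⟨j, hj⟩ := List.getElem?_of_mem hz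
    obtain ⟨t, y, hy, ⟨s, -, hs⟩ | ⟨-, y', hy', rfl⟩⟩ := exists_box _ hj
    · exact (of_mem_privateZones (ih (by omega) (List.mem_of_getElem? hy))
        (fun v hv => (mem_ancestors.1 hv).2) (List.mem_of_getElem? hs)).2.1
    · right
      exact ⟨y, y', rfl, ((hP.isPath i (by omega)).adj_iff hy hy').2 (Or.inl rfl)⟩

/-- A gap of length one would violate the lower bound `k - 2 ≥ 2`. -/
theorem not_marked_marked (hP : IsLayering G l k P) (hk : 4 ≤ k) {i : ℕ} (hi : i ≤ l) {t : ℕ}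
    {x y : V} (hx : (P i)[t]? = some x) (hy : (P i)[t + 1]? = some y) :
    ancestors G P i x = [] ∨ ancestors G P i y = [] := by
  by_contra hc
  push Not at hc
  rcases i with _ | i
  · simp [ancestors] at hc
  obtain ⟨ha, rfl⟩ := List.getElem?_eq_some_iff.1 hx
  obtain ⟨hb, rfl⟩ := List.getElem?_eq_some_iff.1 hy
  have := (hP.gaps i hi t (t + 1) (by omega) hb hc.1 hc.2 (fun c _ _ => by omega)).1
  omega

end IsLayering

theorem getElem?_eq_some_getD {p : List V} (d : V) {a : ℕ} (ha : a < p.length) :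
    p[a]? = some (p.getD a d) := by
  simp [List.getD_eq_getElem?_getD, ha]

/-- The zone of index `j`, with a default value out of range. -/
def zoneAt (zs : List (Zone V)) (d : V) (j : ℕ) : Zone V := (zs[j]?).getD (zoneO d)

theorem getElem?_zoneAt {zs : List (Zone V)} (d : V) {j : ℕ} (hj : j < zs.length) :
    zs[j]? = some (zoneAt zs d j) := by
  simp [zoneAt, hj]

theorem zoneAt_eq {zs : List (Zone V)} (d : V) {j : ℕ} {z : Zone V} (hz : zs[j]? = some z) :
    j < zs.length ∧ zoneAt zs d j = z :=
  ⟨(List.getElem?_eq_some_iff.1 hz).1, by simp [zoneAt, hz]⟩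

namespace IsLayering

variable {l k : ℕ} {P : ℕ → List V}

theorem size_of_mem_zones (hP : IsLayering G l k P) {i : ℕ} (hi : i ≤ l) {z : Zone V}
    (hz : z ∈ zones (ancestors G P i) (P i)) : z.size = 3 ∨ z.size = 4 := by
  obtain ⟨j, hj⟩ := List.getElem?_of_mem hz
  obtain ⟨t, y, hy, ⟨s, -, hs⟩ | ⟨-, y', hy', rfl⟩⟩ := exists_box _ hj
  · exact (of_mem_privateZones (hP.types hi (List.mem_of_getElem? hy))
      (fun v hv => (mem_ancestors.1 hv).2) (List.mem_of_getElem? hs)).1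
  · exact Or.inr rfl

theorem ancestor_notMem (hP : IsLayering G l k P) {i j : ℕ} (hj : j ≤ l) (hij : i ≤ j) {x v : V}
    (hv : v ∈ ancestors G P i x) : v ∉ P j := by
  intro h
  obtain ⟨⟨m, hm, hv'⟩, -⟩ := mem_ancestors.1 hv
  have := hP.eq_of_mem (by omega) hj hv' h
  omega

theorem boxes (hP : IsLayering G l k P) (hk : 4 ≤ k) {i : ℕ} (hi : i ≤ l) (d : V) :
    Boxes G (P i).length (zones (ancestors G P i) (P i)).length (fun t => (P i).getD t d)
      (fun t => ancestors G P i ((P i).getD t d)) (zoneAt (zones (ancestors G P i) (P i)) d)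
      (boxStart (ancestors G P i) (P i)) where
  zone_private t ht s z hz := zoneAt_eq d (zones_private _ (getElem?_eq_some_getD d ht) hz)
  zone_shared t ht := by
    have hx := getElem?_eq_some_getD d (show t < (P i).length by omega)
    have hy := getElem?_eq_some_getD d ht
    obtain ⟨h1, h2⟩ := zoneAt_eq d (zones_shared (ancestors G P i) hx hy)
    exact ⟨h1, h2, boxStart_succ _ hx hy⟩
  start_zero := by simp [boxStart]
  last t ht := length_zones _ (getElem?_eq_some_getD d (by omega)) ht
  local_center t ht j hj hm := by
    have hx := getElem?_eq_some_getD d ht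
    obtain ⟨s, y, hy, ⟨m, rfl, hs⟩ | ⟨e, y', hy', hz⟩⟩ := exists_box _ (getElem?_zoneAt d hj)
    · have hm' := (of_mem_privateZones (hP.types hi (List.mem_of_getElem? hy))
        (fun v hv => (mem_ancestors.1 hv).2) (List.mem_of_getElem? hs)).2.2 _ hm
      have hlt := (List.getElem?_eq_some_iff.1 hs).1
      rcases hm' with h | h
      · have := (hP.isPath i hi).eq_of_eq (hx.trans (congrArg some h)) hy
        subst this
        simp only [h]
        omega
      · exact absurd (List.mem_of_getElem? hx) (hP.ancestor_notMem hi le_rfl h)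
    · rw [hz] at hm
      simp only [zoneEE, List.mem_cons, List.not_mem_nil, or_false] at hm
      rcases hm with h | h
      · have := (hP.isPath i hi).eq_of_eq (hx.trans (congrArg some h)) hy
        subst this
        simp only [h]
        omega
      · have := (hP.isPath i hi).eq_of_eq (hx.trans (congrArg some h)) hy'
        subst this
        have := boxStart_succ (ancestors G P i) hy hy'
        omega
  inj s hs t ht h := (hP.isPath i hi).eq_of_eq (getElem?_eq_some_getD d hs)
    ((getElem?_eq_some_getD d ht).trans (congrArg some h.symm))
  types t ht := hP.types hi (List.mem_of_getElem? (getElem?_eq_some_getD d ht))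
  adj_ancestor t _ v hv := (mem_ancestors.1 hv).2
  ancestor_ne t _ v hv s hs h := by
    refine hP.ancestor_notMem hi le_rfl hv ?_
    rw [h]
    exact List.mem_of_getElem? (getElem?_eq_some_getD d hs)
  sparse t ht := hP.not_marked_marked hk hi (getElem?_eq_some_getD d (by omega))
    (getElem?_eq_some_getD d ht)

theorem exists_topLayer (hP : IsLayering G l k P) (hk : 4 ≤ k) {i : ℕ} (hi : i < l) (d : V) :
    ∃ M μ, Zoning (zones (ancestors G P i) (P i)).length M (fun a => (P (i + 1)).getD a d)
        (ancestors G P (i + 1)) μ (zoneAt (zones (ancestors G P i) (P i)) d)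
        (zoneStart (zones (ancestors G P i) (P i))) ∧
      -- The positions `μ` depend on the layering alone. The set `S` only has to avoid later layers,
      -- so that its vertices off the path adjacent to it are ancestors.
      ∀ S : Finset V, (∀ x ∈ S, ∃ j ≤ i + 1, x ∈ P j) →
        TopLayer G S k (P (i + 1)).length M (fun a => (P (i + 1)).getD a d)
          (ancestors G P (i + 1)) μ := by
  obtain ⟨μ, h1, h2, h3⟩ := exists_filter_positions (fun A : List V => !A.isEmpty)
    ((P (i + 1)).map (ancestors G P (i + 1)))
  set flat := ((P (i + 1)).map (ancestors G P (i + 1))).filter (fun A => !A.isEmpty) with hflat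
  set p : ℕ → V := fun a => (P (i + 1)).getD a d with hp
  set N := (P (i + 1)).length with hN
  have get : ∀ a < N, (P (i + 1))[a]? = some (p a) := fun a ha => getElem?_eq_some_getD d ha
  have getl : ∀ a < N, ∀ h : a < (P (i + 1)).length, (P (i + 1))[a] = p a := fun a ha h => by
    have := get a ha
    rw [List.getElem?_eq_getElem h] at this
    exact Option.some.inj this
  have mem : ∀ a < N, p a ∈ P (i + 1) := fun a ha => List.mem_of_getElem? (get a ha)
  have path := hP.isPath (i + 1) hi
  have lt : ∀ m < flat.length, μ m < N ∧ flat[m]? = some (ancestors G P (i + 1) (p (μ m))) := by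
    intro m hm
    have h := h1 m hm
    rw [List.getElem?_eq_getElem hm] at h
    have hlt := (List.getElem?_eq_some_iff.1 h).1
    rw [List.length_map] at hlt
    refine ⟨hlt, ?_⟩
    rw [← h1 m hm, List.getElem?_map, get _ hlt]
    rfl
  have marked : ∀ m < flat.length, ancestors G P (i + 1) (p (μ m)) ≠ [] := by
    intro m hm
    have := List.mem_of_getElem? (lt m hm).2
    rw [hflat, List.mem_filter] at this
    simpa using this.2
  have pos : ∀ a < N, ancestors G P (i + 1) (p a) ≠ [] → ∃ m < flat.length, μ m = a := by
    intro a ha hA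
    exact h3 a _ (by rw [List.getElem?_map, get a ha]; rfl) (by simpa using hA)
  have un : ∀ m, m + 1 < flat.length → ∀ a, μ m < a → a < μ (m + 1) →
      ancestors G P (i + 1) (p a) = [] := by
    intro m hm a ha1 ha2
    by_contra hA
    obtain ⟨m', hm', rfl⟩ := pos a (ha2.trans (lt _ hm).1) hA
    rcases lt_trichotomy m m' with h | h | h
    · rcases Nat.lt_or_eq_of_le (show m + 1 ≤ m' from h) with h' | h'
      · have := h2 _ _ h' hm'
        omega
      · rw [h'] at ha2
        omega
    · rw [h] at ha1
      omega
    · have := h2 _ _ h (by omega)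
      omega
  have hflat2 : flat = _ := hP.marked i hi
  have gaps : ∀ m, m + 1 < flat.length → _ := fun m hm => by
    have l1 := (lt m (by omega)).1
    have l2 := (lt (m + 1) hm).1
    have h := hP.gaps i hi (μ m) (μ (m + 1)) (h2 m (m + 1) (by omega) hm) l2
    simp only [getl _ l1, getl _ l2] at h
    exact h (marked m (by omega)) (marked _ hm) fun c hc1 hc2 => by
      rw [getl c (by omega)]
      exact un m hm c hc1 hc2
  refine ⟨flat.length, μ, ⟨by simp [zoneStart], fun j hj => ?_, ?_, fun j hj s hs => ?_,
    fun j hj => ?_⟩, fun S hS => ⟨?_, ?_, ?_, ?_, ?_, ?_, ?_, ?_, ?_, ?_, ?_, ?_, ?_, hk, ?_, ?_,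
    ?_⟩⟩
  · exact zoneStart_succ (getElem?_zoneAt d hj)
  · rw [zoneStart_length, hflat2]
  · have hz := getElem?_zoneStart (getElem?_zoneAt d hj) hs
    rw [← hflat2] at hz
    have hlt := (List.getElem?_eq_some_iff.1 hz).1
    exact Option.some.inj ((lt _ hlt).2.symm.trans hz)
  · exact hP.size_of_mem_zones hi.le (List.mem_of_getElem? (getElem?_zoneAt d hj))
  · exact fun a ha b hb h => path.eq_of_eq (get a ha) ((get b hb).trans (congrArg some h.symm))
  · exact fun a ha b hb => path.adj_iff (get a ha) (get b hb)
  · intro a ha y hy hay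
    obtain ⟨j, hj, hyj⟩ := hS y hy
    rcases Nat.lt_or_eq_of_le hj with h | rfl
    · exact Or.inr (mem_ancestors.2 ⟨⟨j, h, hyj⟩, hay⟩)
    · obtain ⟨b, hb, e⟩ := List.getElem_of_mem hyj
      exact Or.inl ⟨b, hb, by rw [← e, getl b hb]⟩
  · exact fun a _ y hy => (mem_ancestors.1 hy).2
  · intro a _ y hy b hb h
    refine hP.ancestor_notMem (j := i + 1) hi le_rfl hy ?_
    rw [h]
    exact mem b hb
  · exact fun a ha => hP.types hi (mem a ha)
  · exact fun m hm => (lt m hm).1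
  · exact fun m hm => h2 m (m + 1) (by omega) hm
  · exact marked
  · exact pos
  · exact un
  · refine fun hpos => hP.ends i hi _ (Or.inl ?_)
    rw [List.head?_eq_getElem?, get 0 hpos]
  · refine fun hpos => hP.ends i hi _ (Or.inr ?_)
    rw [List.getLast?_eq_getElem?, get _ (by omega)]
  · exact fun m hm => by have := (gaps m hm).1; omega
  · exact fun m hm x hx hx' => (gaps m hm).2.1 ⟨x, hx, hx'⟩
  · exact fun m hm h => (gaps m hm).2.2 fun ⟨x, hx, hx'⟩ => h x hx hx'

end IsLayering

/-! ### The two inductions, and cliques. -/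

namespace IsLayering

variable {l k : ℕ} {P : ℕ → List V}

open scoped Classical in
theorem lowDegree_eq_card (hP : IsLayering G l k P) {i : ℕ} (hi : i < l) (d : V) {S : Finset V}
    (hS : ∀ x ∈ S, ∃ j ≤ i + 1, x ∈ P j) {t : ℕ} (ht : t < (P i).length) :
    (S.filter (fun y => G.Adj ((P i).getD t d) y ∧ y ∉ P (i + 1))).card =
      Trace.lowDegree S (P i).length (fun t => (P i).getD t d)
        (fun t => ancestors G P i ((P i).getD t d)) t := by
  have get : ∀ a < (P i).length, (P i)[a]? = some ((P i).getD a d) :=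
    fun a ha => getElem?_eq_some_getD d ha
  have mem : ∀ a < (P i).length, (P i).getD a d ∈ P i := fun a ha => List.mem_of_getElem? (get a ha)
  have path := hP.isPath i hi.le
  have notTop : ∀ x ∈ P i, x ∉ P (i + 1) := fun x hx hx' => by
    have := hP.eq_of_mem hi.le hi hx hx'
    omega
  set u : ℕ → V := fun t => (P i).getD t d with hu
  change (S.filter (fun y => G.Adj (u t) y ∧ y ∉ P (i + 1))).card = _
  set L := ancestors G P i (u t) with hL
  have e : S.filter (fun y => G.Adj (u t) y ∧ y ∉ P (i + 1)) =
      ((if 0 < t then ({u (t - 1)} : Finset V).filter (· ∈ S) else ∅) ∪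
        (if t + 1 < (P i).length then ({u (t + 1)} : Finset V).filter (· ∈ S) else ∅)) ∪
      L.toFinset.filter (· ∈ S) := by
    ext y
    simp only [Finset.mem_filter, Finset.mem_union, List.mem_toFinset]
    constructor
    · rintro ⟨hy, hadj, htop⟩
      obtain ⟨j, hj, hyj⟩ := hS y hy
      rcases Nat.lt_trichotomy j i with h | rfl | h
      · exact Or.inr ⟨mem_ancestors.2 ⟨⟨j, h, hyj⟩, hadj⟩, hy⟩
      · left
        obtain ⟨b, hb⟩ := List.getElem?_of_mem hyj
        have hbl := (List.getElem?_eq_some_iff.1 hb).1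
        have hyb : y = u b := Option.some.inj (hb.symm.trans (get b hbl))
        subst hyb
        rcases (path.adj_iff (get t ht) hb).1 hadj with h | h
        · right
          subst h
          rw [if_pos hbl]
          simpa using hy
        · left
          rw [if_pos (by omega), show t - 1 = b by omega]
          simpa using hy
      · rw [show j = i + 1 by omega] at hyj
        exact absurd hyj htop
    · rintro ((h | h) | ⟨h, hy⟩)
      · split_ifs at h with h0
        · obtain ⟨h1, h2⟩ := Finset.mem_filter.1 h
          rw [Finset.mem_singleton] at h1
          subst h1
          exact ⟨h2, (path.adj_iff (get t ht) (get (t - 1) (by omega))).2 (Or.inr (by omega)),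
            notTop _ (mem _ (by omega))⟩
        · simp at h
      · split_ifs at h with h0
        · obtain ⟨h1, h2⟩ := Finset.mem_filter.1 h
          rw [Finset.mem_singleton] at h1
          subst h1
          exact ⟨h2, (path.adj_iff (get t ht) (get (t + 1) h0)).2 (Or.inl rfl),
            notTop _ (mem _ h0)⟩
        · simp at h
      · exact ⟨hy, (mem_ancestors.1 h).2, hP.ancestor_notMem hi (by omega) h⟩
  have cardS : ∀ x, (({x} : Finset V).filter (· ∈ S)).card = ind (x ∈ S) := fun x => by
    by_cases h : x ∈ S <;> simp [Finset.filter_singleton, ind, h]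
  have hL' : (L.toFinset.filter (· ∈ S)).card = (L.map (fun v => ind (v ∈ S))).sum := by
    rcases hP.types hi.le (mem t ht) with h | ⟨v, h⟩ | ⟨v, w, h, hvw⟩
    · rw [hL]; simp only [hu, h]; simp
    · rw [hL]; simp only [hu, h]; simpa using cardS v
    · rw [hL]; simp only [hu, h]
      have hne := hvw.ne
      by_cases h1 : v ∈ S <;> by_cases h2 : w ∈ S <;>
        simp [Finset.filter_insert, Finset.filter_singleton, ind, h1, h2, hne]
  rw [e, Finset.card_union_of_disjoint, Finset.card_union_of_disjoint, hL', Trace.lowDegree]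
  · congr 2
    · split_ifs
      · exact cardS _
      · rfl
    · split_ifs
      · exact cardS _
      · rfl
  · split_ifs with h1 h2
    · refine Finset.disjoint_filter_filter (Finset.disjoint_singleton.2 fun h => ?_)
      have := path.eq_of_eq (get (t - 1) (by omega)) ((get (t + 1) h2).trans (congrArg some h.symm))
      omega
    all_goals simp
  · rw [Finset.disjoint_right]
    intro y hy hy'
    have hyL := List.mem_toFinset.1 (Finset.mem_filter.1 hy).1
    have hni := hP.ancestor_notMem hi.le le_rfl hyL
    rcases Finset.mem_union.1 hy' with h | h
    · split_ifs at h with h0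
      · rw [Finset.mem_singleton.1 (Finset.mem_filter.1 h).1] at hni
        exact hni (mem _ (by omega))
      · simp at h
    · split_ifs at h with h0
      · rw [Finset.mem_singleton.1 (Finset.mem_filter.1 h).1] at hni
        exact hni (mem _ h0)
      · simp at h

open scoped Classical in
/-- An even induced cycle that is minimal with respect to its trace on the last layer it meets
avoids that layer. -/
theorem notMem_of_minimal (hP : IsLayering G l k P) (hk : 4 ≤ k) {i : ℕ} (hi : i < l) {n : ℕ}
    {F : ℕ → V} (hF : InducedCycle G n F) (hn : ¬ Odd n)
    (hS : ∀ x ∈ verts n F, ∃ j ≤ i + 1, x ∈ P j)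
    (ih : ∀ n' F', InducedCycle G n' F' → (∀ x ∈ verts n' F', ∃ j ≤ i + 1, x ∈ P j) →
      ((verts n' F').filter (· ∈ P (i + 1))).card < ((verts n F).filter (· ∈ P (i + 1))).card →
      Odd n') : ∀ x ∈ verts n F, x ∉ P (i + 1) := by
  have h4 : 4 ≤ n := by
    have := hF.three_le
    rcases Nat.lt_or_eq_of_le this with h | rfl
    · exact h
    · exact absurd (by decide) hn
  intro x hx hxP
  -- The root only serves as a default value for indices out of range.
  obtain ⟨d, -⟩ := hP.root
  obtain ⟨M, μ, hZ, hT⟩ := hP.exists_topLayer hk hi d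
  have H := hT _ hS
  have hB := hP.boxes hk hi.le d
  have tr := hZ.trace H hF hn h4 hB
  set J := (zones (ancestors G P i) (P i)).length with hJ
  set Z := zoneAt (zones (ancestors G P i) (P i)) d with hZdef
  set σ := zoneStart (zones (ancestors G P i) (P i)) with hσ
  set u : ℕ → V := fun t => (P i).getD t d with hu
  set p : ℕ → V := fun a => (P (i + 1)).getD a d with hp
  have memTop : ∀ y, (∃ a < (P (i + 1)).length, y = p a) ↔ y ∈ P (i + 1) := by
    intro y
    constructor
    · rintro ⟨a, ha, rfl⟩
      exact List.mem_of_getElem? (getElem?_eq_some_getD d ha)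
    · intro hy
      obtain ⟨a, ha⟩ := List.getElem?_of_mem hy
      have hlt := (List.getElem?_eq_some_iff.1 ha).1
      exact ⟨a, hlt, Option.some.inj (ha.symm.trans (getElem?_eq_some_getD d hlt))⟩
  have memLow : ∀ t < (P i).length, u t ∈ P i := fun t ht =>
    List.mem_of_getElem? (getElem?_eq_some_getD d ht)
  have htop : ∀ t < (P i).length, Trace.topDegree J Z (zoneCount (verts n F) p μ Z σ) (u t) =
      ((verts n F).filter (fun y => G.Adj (u t) y ∧ y ∈ P (i + 1))).card := by
    intro t ht
    rw [hZ.topDegree_eq_card H]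
    · simp only [memTop]
    · intro a ha
      rw [mem_ancestors]
      exact ⟨fun h => ⟨⟨i, by omega, memLow t ht⟩, h⟩, fun h => h.2⟩
  have hdeg : ∀ t < (P i).length, Trace.topDegree J Z (zoneCount (verts n F) p μ Z σ) (u t) +
      Trace.lowDegree (verts n F) (P i).length u (fun t => ancestors G P i (u t)) t =
      ((verts n F).filter (fun y => G.Adj (u t) y)).card := by
    intro t ht
    rw [htop t ht, ← hP.lowDegree_eq_card hi d hS ht, ← Finset.filter_filter,
      ← Finset.filter_filter]
    exact Finset.card_filter_add_card_filter_not _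
  have regular : ∀ t < (P i).length, u t ∈ verts n F →
      Trace.topDegree J Z (zoneCount (verts n F) p μ Z σ) (u t) +
      Trace.lowDegree (verts n F) (P i).length u (fun t => ancestors G P i (u t)) t = 2 := by
    intro t ht hut
    rw [hdeg t ht]
    exact hF.card_neighbors hut
  have wheel : ∀ t < (P i).length, u t ∉ verts n F →
      3 ≤ Trace.topDegree J Z (zoneCount (verts n F) p μ Z σ) (u t) →
      (Trace.topDegree J Z (zoneCount (verts n F) p μ Z σ) (u t) +
      Trace.lowDegree (verts n F) (P i).length u (fun t => ancestors G P i (u t)) t) % 2 = 0 := by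
    intro t ht hut h3
    rw [hdeg t ht]
    have hutop : u t ∉ P (i + 1) := fun h => by
      have := hP.eq_of_mem hi.le hi (memLow t ht) h
      omega
    have := hF.parity_of_wheel hut (h3.trans (by rw [← hdeg t ht]; omega)) ?_
    · have := Nat.even_iff.1 (Nat.not_odd_iff_even.1 hn)
      omega
    · intro n' F' hF' huF' hsub
      refine ih n' F' hF' (fun x hx => ?_) (Finset.card_lt_card ?_)
      · rcases hsub x hx with rfl | h
        · exact ⟨i, by omega, memLow t ht⟩
        · exact hS x h
      · have hs : (verts n' F').filter (· ∈ P (i + 1)) ⊆ (verts n F).filter (· ∈ P (i + 1)) := by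
          intro y hy
          obtain ⟨h1, h2⟩ := Finset.mem_filter.1 hy
          rcases hsub y h1 with rfl | h
          · exact absurd h2 hutop
          · exact Finset.mem_filter.2 ⟨h, h2⟩
        -- If no top vertex were lost, the at least three top neighbours of `u t` would all be on
        -- the new cycle, where `u t` has only two neighbours.
        refine hs.ssubset_of_ne fun heq => ?_
        rw [htop t ht] at h3
        have h2 := hF'.card_neighbors huF'
        have : (verts n F).filter (fun y => G.Adj (u t) y ∧ y ∈ P (i + 1)) ⊆
            (verts n' F').filter (fun y => G.Adj (u t) y) := by
          intro y hy
          obtain ⟨h5, h6, h7⟩ := Finset.mem_filter.1 hy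
          have : y ∈ (verts n' F').filter (· ∈ P (i + 1)) := by
            rw [heq]
            exact Finset.mem_filter.2 ⟨h5, h7⟩
          exact Finset.mem_filter.2 ⟨(Finset.mem_filter.1 this).1, h6⟩
        have := Finset.card_le_card this
        omega
  obtain ⟨a, ha, rfl⟩ := (memTop x).2 hxP
  obtain ⟨m, hm, hmS, -⟩ := H.exists_pos_of_mem hF ha hx
  obtain ⟨j, hj, s, hs, rfl⟩ := hZ.exists_zone hm
  have hN : 0 < (P i).length := by
    rcases Nat.eq_zero_or_pos (P i).length with h | h
    · rw [List.length_eq_zero_iff] at h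
      rw [hJ, h] at hj
      simp [zones] at hj
    · exact h
  have hc := tr.count_eq_zero hN wheel regular hj
  have := Finset.sum_eq_zero_iff.1 hc s (Finset.mem_range.2 hs)
  exact ind_eq_zero.1 this hmS

theorem odd_of_inducedCycle (hP : IsLayering G l k P) (hk : 4 ≤ k) {i : ℕ} (hi : i ≤ l) {n : ℕ}
    {F : ℕ → V} (hF : InducedCycle G n F) (hS : ∀ x ∈ verts n F, ∃ j ≤ i, x ∈ P j) : Odd n := by
  classical
  induction i generalizing n F with
  | zero =>
    exfalso
    obtain ⟨r, hr⟩ := hP.root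
    have hsub : verts n F ⊆ {r} := by
      intro x hx
      obtain ⟨j, hj, hxj⟩ := hS x hx
      obtain rfl : j = 0 := by omega
      rw [hr] at hxj
      simpa using hxj
    have := Finset.card_le_card hsub
    rw [hF.card_verts, Finset.card_singleton] at this
    have := hF.three_le
    omega
  | succ i ihi =>
    -- The measure is the trace on the top layer, not the length: the cycles built from sectors gain
    -- the vertex `u`, which is in a lower layer.
    induction hm : ((verts n F).filter (· ∈ P (i + 1))).card using Nat.strong_induction_on
      generalizing n F with
    | _ m ih =>
    by_contra hn
    have hnot := hP.notMem_of_minimal hk hi hF hn hS fun n' F' hF' hS' hlt =>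
      ih _ (hm ▸ hlt) hF' hS' rfl
    refine hn (ihi (by omega) hF fun x hx => ?_)
    obtain ⟨j, hj, hxj⟩ := hS x hx
    rcases Nat.lt_or_eq_of_le hj with h | rfl
    · exact ⟨j, by omega, hxj⟩
    · exact absurd hxj (hnot x hx)

theorem le_of_inducedCycle (hP : IsLayering G l k P) (hk : 4 ≤ k) {i : ℕ} (hi : i ≤ l) {n : ℕ}
    {F : ℕ → V} (hF : InducedCycle G n F) (hn : 4 ≤ n)
    (hS : ∀ x ∈ verts n F, ∃ j ≤ i, x ∈ P j) : k ≤ n := by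
  induction i with
  | zero =>
    exfalso
    obtain ⟨r, hr⟩ := hP.root
    have hsub : verts n F ⊆ {r} := by
      intro x hx
      obtain ⟨j, hj, hxj⟩ := hS x hx
      obtain rfl : j = 0 := by omega
      rw [hr] at hxj
      simpa using hxj
    have := Finset.card_le_card hsub
    rw [hF.card_verts, Finset.card_singleton] at this
    omega
  | succ i ih =>
    by_cases h : ∃ x ∈ verts n F, x ∈ P (i + 1)
    · obtain ⟨x, hx, hxP⟩ := h
      obtain ⟨d, -⟩ := hP.root
      obtain ⟨M, μ, -, hT⟩ := hP.exists_topLayer hk hi d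
      obtain ⟨a, ha⟩ := List.getElem?_of_mem hxP
      have hlt := (List.getElem?_eq_some_iff.1 ha).1
      have hxa := Option.some.inj (ha.symm.trans (getElem?_eq_some_getD d hlt))
      exact (hT _ hS).le_length hF hn hlt (hxa ▸ hx)
    · push Not at h
      refine ih (by omega) fun x hx => ?_
      obtain ⟨j, hj, hxj⟩ := hS x hx
      rcases Nat.lt_or_eq_of_le hj with h' | rfl
      · exact ⟨j, by omega, hxj⟩
      · exact absurd hxj (h x hx)

/-- Look at the latest layer met by the clique. If it holds a single clique vertex, the other three
are ancestors of it, one too many. If it holds two, they are consecutive on the path, and a third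
one is either on the path, which has no triangle, or a common ancestor, so that two consecutive
vertices are marked. -/
theorem cliqueFree (hP : IsLayering G l k P) (hk : 4 ≤ k) : G.CliqueFree 4 := by
  classical
  intro T hT
  choose f hf _ using hP.partition
  have hTne : T.Nonempty := Finset.card_pos.1 (by rw [hT.card_eq]; norm_num)
  obtain ⟨x, hx, hmax⟩ := T.exists_max_image f hTne
  have adj : ∀ y ∈ T, ∀ z ∈ T, y ≠ z → G.Adj y z := fun y hy z hz => hT.isClique hy hz
  have low : ∀ x' ∈ T, ∀ y ∈ T, y ≠ x' → y ∉ P (f x) →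
      y ∈ ancestors G P (f x) x' := by
    intro x' hx' y hy hne hyP
    refine mem_ancestors.2 ⟨⟨f y, ?_, (hf y).2⟩, adj x' hx' y hy hne.symm⟩
    rcases Nat.lt_or_eq_of_le (hmax y hy) with h | h
    · exact h
    · exact absurd (h ▸ (hf y).2) hyP
  by_cases hex : ∃ y ∈ T, y ≠ x ∧ y ∈ P (f x)
  · obtain ⟨y, hy, hyx, hyP⟩ := hex
    obtain ⟨z, hz⟩ : ((T.erase x).erase y).Nonempty := by
      rw [← Finset.card_pos, Finset.card_erase_of_mem (by simp [hy, hyx]),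
        Finset.card_erase_of_mem hx, hT.card_eq]
      norm_num
    simp only [Finset.mem_erase] at hz
    obtain ⟨hzy, hzx, hz⟩ := hz
    obtain ⟨a, ha⟩ := List.getElem?_of_mem (hf x).2
    obtain ⟨b, hb⟩ := List.getElem?_of_mem hyP
    have path := hP.isPath _ (hf x).1
    have hab := (path.adj_iff ha hb).1 (adj x hx y hy hyx.symm)
    by_cases hzP : z ∈ P (f x)
    · obtain ⟨c, hc⟩ := List.getElem?_of_mem hzP
      have hac := (path.adj_iff ha hc).1 (adj x hx z hz hzx.symm)
      have hbc := (path.adj_iff hb hc).1 (adj y hy z hz hzy.symm)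
      omega
    · have hxA := List.ne_nil_of_mem (low x hx z hz hzx hzP)
      have hyA := List.ne_nil_of_mem (low y hy z hz hzy hzP)
      rcases hab with rfl | rfl
      · rcases hP.not_marked_marked hk (hf x).1 ha hb with h | h
        · exact hxA h
        · exact hyA h
      · rcases hP.not_marked_marked hk (hf x).1 hb ha with h | h
        · exact hyA h
        · exact hxA h
  · push Not at hex
    have hlen : (ancestors G P (f x) x).toFinset.card ≤ 2 := by
      refine (List.toFinset_card_le _).trans ?_
      rcases hP.types (hf x).1 (hf x).2 with h | ⟨v, h⟩ | ⟨v, w, h, -⟩ <;> simp [h]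
    have hsub : T.erase x ⊆ (ancestors G P (f x) x).toFinset := by
      intro y hy
      obtain ⟨h1, h2⟩ := Finset.mem_erase.1 hy
      exact List.mem_toFinset.2 (low x hx y h2 h1 (hex y h2 h1))
    have hcard := Finset.card_le_card hsub
    rw [Finset.card_erase_of_mem hx, hT.card_eq] at hcard
    omega

end IsLayering

end LayeredWheel

theorem mainTheorem2 {V : Type*} (G : SimpleGraph V) (l k : ℕ) (hl : 1 ≤ l) (hk : 4 ≤ k)
    (hG : LayeredWheel.IsEhfLayeredWheel l k G) :
    (∀ (v : V) (c : G.Walk v v), LayeredWheel.IsHole c → ¬ Even c.length) ∧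
    G.CliqueFree 4 ∧
    (∀ (v : V) (c : G.Walk v v), LayeredWheel.IsHole c → k ≤ c.length) := by
  obtain ⟨P, hP⟩ := hG
  have layer : ∀ x, ∃ j ≤ l, x ∈ P j := fun x => by
    obtain ⟨j, ⟨h1, h2⟩, -⟩ := hP.partition x
    exact ⟨j, h1, h2⟩
  refine ⟨fun v c hc => ?_, hP.cliqueFree hk, fun v c hc => ?_⟩
  · obtain ⟨F, hF⟩ := hc.inducedCycle
    exact Nat.not_even_iff_odd.2 (hP.odd_of_inducedCycle hk le_rfl hF fun x _ => layer x)
  · obtain ⟨F, hF⟩ := hc.inducedCycle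
    exact hP.le_of_inducedCycle hk le_rfl hF hc.2.2 fun x _ => layer x
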